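/- **Lemma 4.2 (asymptotic equicontinuity of value functions).** Let $n\ge 1$, $2<p<\infty$, $T>0$, and let $\Omega\subset\mathbb R^n$ be a bounded domain satisfying the uniform exterior sphere condition: there is $\delta>0$ such that for every $y\in\partial\Omega$ there is an open ball $B_\delta\subset\mathbb R^n\setminus\Omega$ of radius $\delta$ with $\overline B_\delta\cap\overline\Omega=\{y\}$. Put $\Omega_T=\Omega\times(0,T)$ and, for $\varepsilon>0$, $$S_\varepsilon=\{x\in\mathbb R^n\setminus\Omega:\operatorname{dist}(x,\partial\Omega)\le\varepsilon\},\qquad \Gamma_\varepsilon=\big(S_\varepsilon\times[-\varepsilon^2,T]\big)\cup\big(\Omega\times[-\varepsilon^2,0]\big).$$ Let $F:\Gamma_1\to\mathbb R$ be continuous, $\alpha=\frac{p-2}{p+n}$ and $\beta=\frac{n+2}{p+n}$. For $\varepsilon\in(0,1)$ consider the following control problem. A token starts at $(x_0,t_0)\in\overline\Omega_T=\overline{\Omega}\times[0,T]$. A strategy $S$ is a Borel measurable rule assigning to each history a unit vector $\sigma=S(t_0,x_0,\dots,x_k)\in\mathbb R^n$. Given the history, $t_{k+1}=t_k-\varepsilon^2$,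 and $x_{k+1}$ is, with probability $\beta$, uniformly distributed in the ball $B_\varepsilon(x_k)$, and equals $x_k+\varepsilon\sigma$ and $x_k-\varepsilon\sigma$ with probability $\alpha/2$ each. Let $\tau$ be the first $k\ge 0$ with $(x_k,t_k)\in\Gamma_\varepsilon$ (so $\tau=0$ if the token starts in $\Gamma_\varepsilon$), and let $$u_\varepsilon(x_0,t_0)=\sup_S\mathbb E_S^{(x_0,t_0)}\big[F(x_\tau,t_\tau)\big]$$ be the value of the game. Then: 1. $|u_\varepsilon(x,t)|\le\max_{\Gamma_1}|F|$ for all $(x,t)\in\overline\Omega_T$ and all $\varepsilon\in(0,1)$. 2. For every $\eta>0$ there are $r_0>0$ and $\varepsilon_0>0$ such that for every $\varepsilon\in(0,1)$ with $\varepsilon<\varepsilon_0$ and all $(x,t),(y,s)\in\overline\Omega_T$ with $|(x,t)-(y,s)|<r_0$, $$|u_\varepsilon(x,t)-u_\varepsilon(y,s)|<\eta.$$ -/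

import Mathlib

open MeasureTheory ProbabilityTheory
open scoped ENNReal

namespace DominativeGame

noncomputable section

/-- Euclidean space `ℝⁿ`. -/
abbrev Space (n : ℕ) : Type := EuclideanSpace ℝ (Fin n)

/-- Bounded domains satisfying the uniform exterior sphere condition. -/
structure IsGameDomain {n : ℕ} (Ω : Set (Space n)) : Prop where
  isOpen : IsOpen Ω
  isConnected : IsConnected Ω
  isBounded : Bornology.IsBounded Ω
  exteriorSphere : ∃ δ : ℝ, 0 < δ ∧ ∀ y ∈ frontier Ω, ∃ z : Space n,
    Metric.ball z δ ⊆ Ωᶜ ∧ Metric.closedBall z δ ∩ closure Ω = {y}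

/-- The open space-time cylinder `Ω × (0, T)`. -/
def cylinder {n : ℕ} (Ω : Set (Space n)) (T : ℝ) : Set (Space n × ℝ) :=
  Ω ×ˢ Set.Ioo 0 T

/-- The outer strip `{x ∉ Ω : dist (x, ∂Ω) ≤ ε}`. -/
def outerStrip {n : ℕ} (Ω : Set (Space n)) (ε : ℝ) : Set (Space n) :=
  {x | x ∉ Ω ∧ Metric.infDist x (frontier Ω) ≤ ε}

/-- The parabolic boundary strip of width `ε`: the lateral part runs over all times in
`[-ε², T]`, the bottom part over times in `[-ε², 0]`. -/
def boundaryStrip {n : ℕ} (Ω : Set (Space n)) (T ε : ℝ) : Set (Space n × ℝ) :=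
  (outerStrip Ω ε ×ˢ Set.Icc (-ε ^ 2) T) ∪ (Ω ×ˢ Set.Icc (-ε ^ 2) 0)

/-- The Euclidean distance of `ℝⁿ⁺¹` between two space-time points. -/
def spaceTimeDist {n : ℕ} (P Q : Space n × ℝ) : ℝ :=
  Real.sqrt (‖P.1 - Q.1‖ ^ 2 + (P.2 - Q.2) ^ 2)

/-- A strategy of the controller: Borel functions giving a unit vector for each starting time
`t₀` and each history `x₀, …, x_k` of positions. -/
structure Strategy (n : ℕ) where
  dir : (k : ℕ) → ℝ → (Finset.Iic k → Space n) → Space n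
  measurable_dir : ∀ k, Measurable (Function.uncurry (dir k))
  norm_dir : ∀ k t₀ h, ‖dir k t₀ h‖ = 1

/-- Probability that the controller chooses the direction of the move. -/
def coinAlpha (n : ℕ) (p : ℝ) : ℝ := (p - 2) / (p + n)

/-- Probability of a uniformly random move. -/
def coinBeta (n : ℕ) (p : ℝ) : ℝ := (n + 2) / (p + n)

/-- Law of the next position, from the position `x` with chosen direction `σ`: with probability
`β` uniform in the ball `B_ε(x)`, and with probability `α / 2` each of the points `x ± ε σ`. -/
def stepMeasure {n : ℕ} (p ε : ℝ) (x σ : Space n) : Measure (Space n) :=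
  ENNReal.ofReal (coinBeta n p) • (volume : Measure (Space n))[|Metric.ball x ε]
    + ENNReal.ofReal (coinAlpha n p / 2) • Measure.dirac (x + ε • σ)
    + ENNReal.ofReal (coinAlpha n p / 2) • Measure.dirac (x - ε • σ)

lemma measurable_stepMeasure {n : ℕ} (p ε : ℝ) :
    Measurable (fun q : Space n × Space n => stepMeasure p ε q.1 q.2) := by
  refine Measure.measurable_of_measurable_coe _ fun A hA => ?_
  have hball : Measurable fun x : Space n => volume (Metric.ball x ε ∩ A) := by
    have hs1 : MeasurableSet {q : Space n × Space n | dist q.2 q.1 < ε} :=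
      (isOpen_lt (continuous_snd.dist continuous_fst) continuous_const).measurableSet
    have hs2 : MeasurableSet {q : Space n × Space n | q.2 ∈ A} := measurable_snd hA
    exact measurable_measure_prodMk_left (hs1.inter hs2)
  have h1 : Measurable fun q : Space n × Space n =>
      ((volume : Measure (Space n))[|Metric.ball q.1 ε]) A := by
    have : ∀ q : Space n × Space n, ((volume : Measure (Space n))[|Metric.ball q.1 ε]) A
        = (volume (Metric.ball (0 : Space n) ε))⁻¹ * volume (Metric.ball q.1 ε ∩ A) := by
      intro q
      rw [cond_apply measurableSet_ball, Measure.addHaar_ball_center]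
    simp only [this]
    exact (hball.comp measurable_fst).const_mul _
  have hd : Measurable fun x : Space n => Measure.dirac x A :=
    (Measure.measurable_coe hA).comp Measure.measurable_dirac
  have c2 : Measurable fun q : Space n × Space n => q.1 + ε • q.2 :=
    (continuous_fst.add (continuous_snd.const_smul ε)).measurable
  have c3 : Measurable fun q : Space n × Space n => q.1 - ε • q.2 :=
    (continuous_fst.sub (continuous_snd.const_smul ε)).measurable
  have h2 : Measurable fun q : Space n × Space n => Measure.dirac (q.1 + ε • q.2) A :=
    hd.comp c2
  have h3 : Measurable fun q : Space n × Space n => Measure.dirac (q.1 - ε • q.2) A :=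
    hd.comp c3
  simp only [stepMeasure, Measure.add_apply, Measure.smul_apply, smul_eq_mul]
  exact ((h1.const_mul _).add (h2.const_mul _)).add (h3.const_mul _)

lemma isProbabilityMeasure_stepMeasure {n : ℕ} {p ε : ℝ} (hp : 2 < p) (hε : 0 < ε)
    (x σ : Space n) : IsProbabilityMeasure (stepMeasure p ε x σ) := by
  have hb0 : volume (Metric.ball x ε) ≠ 0 := (Metric.measure_ball_pos volume x hε).ne'
  have : IsProbabilityMeasure ((volume : Measure (Space n))[|Metric.ball x ε]) :=
    cond_isProbabilityMeasure_of_finite hb0 measure_ball_lt_top.ne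
  have hpn : 0 < p + n := by positivity
  have hα : 0 ≤ coinAlpha n p / 2 :=
    div_nonneg (div_nonneg (by linarith) hpn.le) (by norm_num)
  have hβ : 0 ≤ coinBeta n p := div_nonneg (by positivity) hpn.le
  refine ⟨?_⟩
  simp only [stepMeasure, Measure.add_apply, Measure.smul_apply, smul_eq_mul, measure_univ,
    mul_one]
  rw [← ENNReal.ofReal_add hβ hα, ← ENNReal.ofReal_add (add_nonneg hβ hα) hα,
    ENNReal.ofReal_eq_one]
  simp only [coinAlpha, coinBeta]
  field_simp
  ring

lemma measurable_stepLaw {n : ℕ} (p ε : ℝ) (S : Strategy n) (t₀ : ℝ) (k : ℕ) :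
    Measurable (fun h : Finset.Iic k → Space n =>
      stepMeasure p ε (h ⟨k, Finset.mem_Iic.2 le_rfl⟩) (S.dir k t₀ h)) := by
  have h1 : Measurable fun h : Finset.Iic k → Space n => h ⟨k, Finset.mem_Iic.2 le_rfl⟩ :=
    measurable_pi_apply _
  have h0 : Measurable fun h : Finset.Iic k → Space n => (t₀, h) := measurable_prodMk_left
  have h2 : Measurable fun h : Finset.Iic k → Space n => S.dir k t₀ h :=
    (S.measurable_dir k).comp h0
  have h3 := (measurable_stepMeasure (n := n) p ε).comp (h1.prodMk h2)
  simpa only [Function.comp_def] using h3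

/-- The transition kernel of the game with starting time `t₀` and strategy `S`, from the history
of positions `x₀, …, x_k` to the position `x_{k+1}`. The time component of the token is
deterministic, `t_k = t₀ - k ε²`, and is not part of the random state. -/
def stepKernel {n : ℕ} {p ε : ℝ} (_hp : 2 < p) (_hε : 0 < ε) (S : Strategy n) (t₀ : ℝ) (k : ℕ) :
    Kernel (Finset.Iic k → Space n) (Space n) where
  toFun h := stepMeasure p ε (h ⟨k, Finset.mem_Iic.2 le_rfl⟩) (S.dir k t₀ h)
  measurable' := measurable_stepLaw p ε S t₀ k

instance {n : ℕ} {p ε : ℝ} (hp : 2 < p) (hε : 0 < ε) (S : Strategy n) (t₀ : ℝ) (k : ℕ) :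
    IsMarkovKernel (stepKernel hp hε S t₀ k) :=
  ⟨fun _ => isProbabilityMeasure_stepMeasure hp hε _ _⟩

/-- The law of the sequence of token positions for the starting point `(x₀, t₀) = P` and the
strategy `S`, given by the Ionescu-Tulcea theorem. -/
def gameMeasure {n : ℕ} {p ε : ℝ} (hp : 2 < p) (hε : 0 < ε) (S : Strategy n)
    (P : Space n × ℝ) : Measure (ℕ → Space n) :=
  Kernel.traj (X := fun _ => Space n) (stepKernel hp hε S P.2) 0 (fun _ => P.1)

/-- The token `(x_k, t_k)` after `k` rounds of a game started at time `t₀`. -/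
def token {n : ℕ} (ε t₀ : ℝ) (ω : ℕ → Space n) (k : ℕ) : Space n × ℝ :=
  (ω k, t₀ - k * ε ^ 2)

/-- The first round at which the token lies in the boundary strip. A token started in
`closure (Ω × (0, T))` almost surely reaches the strip, after at most `t₀ / ε² + 1` rounds. -/
def stoppingRound {n : ℕ} (Ω : Set (Space n)) (T ε t₀ : ℝ) (ω : ℕ → Space n) : ℕ :=
  sInf {k | token ε t₀ ω k ∈ boundaryStrip Ω T ε}

/-- The expected payoff of the controller under the strategy `S`, from the starting point `P`. -/
def expectedPayoff {n : ℕ} {p ε : ℝ} (hp : 2 < p) (hε : 0 < ε) (Ω : Set (Space n)) (T : ℝ)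
    (F : Space n × ℝ → ℝ) (S : Strategy n) (P : Space n × ℝ) : ℝ :=
  ∫ ω, F (token ε P.2 ω (stoppingRound Ω T ε P.2 ω)) ∂(gameMeasure hp hε S P)

/-- The value of the game with starting point `P`. -/
def value {n : ℕ} {p ε : ℝ} (hp : 2 < p) (hε : 0 < ε) (Ω : Set (Space n)) (T : ℝ)
    (F : Space n × ℝ → ℝ) (P : Space n × ℝ) : ℝ :=
  ⨆ S : Strategy n, expectedPayoff hp hε Ω T F S P

end

end DominativeGame

/-!
Let `S` be a strategy for the game started at `P`. Carry it over to the game started at `Q` by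
translating all positions by `P - Q`. Both games can then be played with the same displacements, so
the two tokens stay at the distance of their starting points until one game ends. If it ends because
its token leaves `Ω`, the other token is near `∂Ω`.

To show that the other game will be over soon, take a Lipschitz function `G` that vanishes on `∂Ω`,
is nonpositive in `Ω`, and whose mean grows by at least `ε ^ 2` in every round, whatever the
strategy. Such a `G` is obtained from `exp (-λ * ρ ^ 2)` for large `λ`, where `ρ` is the distance to
the set of centres of exterior balls. Near `∂Ω` it is small, so by optional stopping the expected
number of remaining rounds is small compared with `ε⁻²`. As the steps are symmetric, the squared
displacement in these rounds is in the mean at most `ε ^ 2` times their number. Hence the final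
tokens of the two games are close in mean, and the uniform continuity of `F` on the compact set `Γ₁`
gives the estimate.
-/

namespace DominativeGame

section SymmetricStep

variable {E : Type*} [NormedAddCommGroup E] [MeasurableSpace E]

/-- `μ` is a possible law of a move from `x`: it is symmetric about `x` and supported in the closed
`ε`-ball around `x`. -/
structure IsSymmetricStep (μ : Measure E) (x : E) (ε : ℝ) : Prop where
  map_reflect : μ.map (fun y => x + x - y) = μ
  ae_norm_sub_le : ∀ᵐ y ∂μ, ‖y - x‖ ≤ ε

namespace IsSymmetricStep

variable [BorelSpace E] {μ : Measure E} {x : E} {ε : ℝ}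

lemma integral_reflect (hμ : IsSymmetricStep μ x ε) {f : E → ℝ} (hf : Continuous f) :
    ∫ y, f (x + x - y) ∂μ = ∫ y, f y ∂μ := by
  conv_rhs => rw [← hμ.map_reflect]
  exact (integral_map (by fun_prop) hf.aestronglyMeasurable).symm

variable [ProperSpace E] [IsFiniteMeasure μ]

lemma integrable_of_continuous (hμ : IsSymmetricStep μ x ε) {f : E → ℝ} (hf : Continuous f) :
    Integrable f μ := by
  obtain ⟨C, hC⟩ := (isCompact_closedBall x ε).exists_bound_of_continuousOn hf.continuousOn
  refine Integrable.of_bound hf.aestronglyMeasurable C ?_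
  filter_upwards [hμ.ae_norm_sub_le] with y hy
  exact hC y (by rwa [Metric.mem_closedBall, dist_eq_norm])

lemma integral_le_of_le_average (hμ : IsSymmetricStep μ x ε) {f g : E → ℝ} (hf : Continuous f)
    (hg : Continuous g) (h : ∀ y, ‖y - x‖ ≤ ε → g y ≤ (f y + f (x + x - y)) / 2) :
    ∫ y, g y ∂μ ≤ ∫ y, f y ∂μ := by
  have hfi := hμ.integrable_of_continuous hf
  have hfi' : Integrable (fun y => f (x + x - y)) μ :=
    hμ.integrable_of_continuous (by fun_prop)
  calc ∫ y, g y ∂μ ≤ ∫ y, (f y + f (x + x - y)) / 2 ∂μ :=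
        integral_mono_ae (hμ.integrable_of_continuous hg) ((hfi.add hfi').div_const 2)
          (hμ.ae_norm_sub_le.mono h)
    _ = ∫ y, f y ∂μ := by
        rw [integral_div, integral_add hfi hfi', hμ.integral_reflect hf]
        ring

end IsSymmetricStep

end SymmetricStep

section SymmetricStepInner

variable {E : Type*} [NormedAddCommGroup E] [InnerProductSpace ℝ E]

lemma one_add_sq_half_le_cosh (s : ℝ) : 1 + s ^ 2 / 2 ≤ Real.cosh s := by
  have hcosh : Real.cosh s = 1 + 2 * Real.sinh (s / 2) ^ 2 := by
    rw [← mul_div_cancel₀ s two_ne_zero, Real.cosh_two_mul, Real.cosh_sq,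
      mul_div_cancel_left₀ _ two_ne_zero]
    ring
  have hsinh : (s / 2) ^ 2 ≤ Real.sinh (s / 2) ^ 2 := by
    rw [sq_le_sq, Real.abs_sinh]
    exact Real.self_le_sinh_iff.2 (abs_nonneg _)
  linarith

lemma le_average_gaussian (lam : ℝ) (v h : E) :
    Real.exp (-lam * ‖v‖ ^ 2) * ((1 - lam * ‖h‖ ^ 2) * (1 + 2 * lam ^ 2 * inner ℝ v h ^ 2))
      ≤ (Real.exp (-lam * ‖v + h‖ ^ 2) + Real.exp (-lam * ‖v - h‖ ^ 2)) / 2 := by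
  have hcosh : 1 + 2 * lam ^ 2 * inner ℝ v h ^ 2 ≤ Real.cosh (2 * lam * inner ℝ v h) :=
    (by ring : _ = _).trans_le (one_add_sq_half_le_cosh _)
  calc _ ≤ Real.exp (-lam * ‖v‖ ^ 2)
        * (Real.exp (-lam * ‖h‖ ^ 2) * Real.cosh (2 * lam * inner ℝ v h)) := by
        gcongr
        linarith [Real.add_one_le_exp (-lam * ‖h‖ ^ 2)]
    _ = _ := by
        rw [norm_add_sq_real, norm_sub_sq_real, Real.cosh_eq, ← mul_div_assoc, ← mul_div_assoc,
          mul_add, mul_add, ← Real.exp_add, ← Real.exp_add, ← Real.exp_add, ← Real.exp_add,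
          add_comm]
        ring_nf

namespace IsSymmetricStep

variable [ProperSpace E] [MeasurableSpace E] [BorelSpace E] {μ : Measure E}
  [IsProbabilityMeasure μ] {x : E} {ε : ℝ}

lemma integral_norm_sub_sq_le (hμ : IsSymmetricStep μ x ε) (a : E) :
    ∫ y, ‖y - a‖ ^ 2 ∂μ ≤ ‖x - a‖ ^ 2 + ε ^ 2 := by
  have h : ∫ _, -(‖x - a‖ ^ 2 + ε ^ 2) ∂μ ≤ ∫ y, -‖y - a‖ ^ 2 ∂μ := by
    refine hμ.integral_le_of_le_average (by fun_prop) continuous_const fun y hy => ?_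
    have hsq : ‖y - x‖ ^ 2 ≤ ε ^ 2 := by gcongr
    have hpar := parallelogram_law_with_norm ℝ (x - a) (y - x)
    rw [show x - a + (y - x) = y - a by abel, show x - a - (y - x) = x + x - y - a by abel]
      at hpar
    nlinarith
  simpa only [integral_neg, integral_const, probReal_univ, one_smul, neg_le_neg_iff] using h

lemma le_integral_gaussian (hμ : IsSymmetricStep μ x ε) {lam : ℝ} (hlam : 0 ≤ lam) (z : E) :
    Real.exp (-lam * ‖x - z‖ ^ 2)
        * ((1 - lam * ε ^ 2) * (1 + 2 * lam ^ 2 * ∫ y, inner ℝ (x - z) (y - x) ^ 2 ∂μ))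
      ≤ ∫ y, Real.exp (-lam * ‖y - z‖ ^ 2) ∂μ := by
  have hint : Integrable (fun y => inner ℝ (x - z) (y - x) ^ 2) μ :=
    hμ.integrable_of_continuous (by fun_prop)
  calc _ = ∫ y, Real.exp (-lam * ‖x - z‖ ^ 2)
        * ((1 - lam * ε ^ 2) * (1 + 2 * lam ^ 2 * inner ℝ (x - z) (y - x) ^ 2)) ∂μ := by
        rw [integral_const_mul, integral_const_mul,
          integral_add (integrable_const _) (hint.const_mul _), integral_const_mul]
        simp
    _ ≤ _ := by
        refine hμ.integral_le_of_le_average (by fun_prop) (by fun_prop) fun y hy => ?_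
        refine le_trans ?_ ((le_average_gaussian lam (x - z) (y - x)).trans_eq ?_)
        · gcongr
        · rw [show x - z + (y - x) = y - z by abel, show x - z - (y - x) = x + x - y - z by abel]

end IsSymmetricStep

end SymmetricStepInner

section StepMeasure

variable {n : ℕ} {p ε : ℝ} {x σ : Space n}

lemma map_cond_of_measurePreserving {X : Type*} [MeasurableSpace X] {μ : Measure X} {g : X → X}
    (hg : MeasurePreserving g μ μ) {A : Set X} (hA : MeasurableSet A) :
    (μ[|g ⁻¹' A]).map g = μ[|A] := by
  ext B hB
  rw [Measure.map_apply hg.measurable hB, cond_apply (hg.measurable hA), cond_apply hA,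
    ← Set.preimage_inter, hg.measure_preimage hA.nullMeasurableSet,
    hg.measure_preimage (hA.inter hB).nullMeasurableSet]

lemma map_stepMeasure_of_measurePreserving {g : Space n → Space n}
    (hg : MeasurePreserving g (volume : Measure (Space n)) volume) {x' : Space n}
    (hball : g ⁻¹' Metric.ball x' ε = Metric.ball x ε) :
    (stepMeasure p ε x σ).map g =
      ENNReal.ofReal (coinBeta n p) • (volume : Measure (Space n))[|Metric.ball x' ε]
        + ENNReal.ofReal (coinAlpha n p / 2) • Measure.dirac (g (x + ε • σ))
        + ENNReal.ofReal (coinAlpha n p / 2) • Measure.dirac (g (x - ε • σ)) := by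
  rw [stepMeasure, Measure.map_add _ _ hg.measurable, Measure.map_add _ _ hg.measurable,
    Measure.map_smul, Measure.map_smul, Measure.map_smul, Measure.map_dirac' hg.measurable,
    Measure.map_dirac' hg.measurable, ← hball,
    map_cond_of_measurePreserving hg measurableSet_ball]

lemma map_add_right_stepMeasure (ξ : Space n) :
    (stepMeasure p ε x σ).map (· + ξ) = stepMeasure p ε (x + ξ) σ := by
  rw [map_stepMeasure_of_measurePreserving (x' := x + ξ) (measurePreserving_add_right volume ξ)
    (by ext y; simp [dist_eq_norm]), stepMeasure, add_right_comm x, sub_add_eq_add_sub]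

lemma map_reflect_stepMeasure :
    (stepMeasure p ε x σ).map (fun y => x + x - y) = stepMeasure p ε x σ := by
  have hball : (fun y => x + x - y) ⁻¹' Metric.ball x ε = Metric.ball x ε := by
    ext y
    rw [Set.mem_preimage, mem_ball_iff_norm, mem_ball_iff_norm',
      show x + x - y - x = x - y by abel]
  rw [map_stepMeasure_of_measurePreserving (Measure.measurePreserving_sub_left volume (x + x))
    hball, show x + x - (x + ε • σ) = x - ε • σ by abel,
    show x + x - (x - ε • σ) = x + ε • σ by abel, stepMeasure, add_right_comm]

lemma ae_norm_sub_le_stepMeasure (hε : 0 ≤ ε) (hσ : ‖σ‖ = 1) :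
    ∀ᵐ y ∂(stepMeasure p ε x σ), ‖y - x‖ ≤ ε := by
  have hball : ∀ᵐ y ∂((volume : Measure (Space n))[|Metric.ball x ε]), ‖y - x‖ ≤ ε :=
    (ae_cond_mem measurableSet_ball).mono fun y hy => (mem_ball_iff_norm.1 hy).le
  have hnorm : ‖ε • σ‖ = ε := by rw [norm_smul, hσ, mul_one, Real.norm_of_nonneg hε]
  rw [stepMeasure, ae_add_measure_iff, ae_add_measure_iff]
  refine ⟨⟨Measure.ae_smul_measure hball _, Measure.ae_smul_measure ?_ _⟩,
    Measure.ae_smul_measure ?_ _⟩ <;>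
  simp [hnorm]

lemma isSymmetricStep_stepMeasure (hε : 0 ≤ ε) (hσ : ‖σ‖ = 1) :
    IsSymmetricStep (stepMeasure p ε x σ) x ε :=
  ⟨map_reflect_stepMeasure, ae_norm_sub_le_stepMeasure hε hσ⟩

lemma coinBeta_pos (n : ℕ) (hp : 0 < p) : 0 < coinBeta n p := by
  unfold coinBeta
  positivity

lemma cond_ball_apply_ball {z : Space n} {r : ℝ} (hr : 0 < r) (hε : 0 < ε)
    (hsub : Metric.ball z r ⊆ Metric.ball x ε) :
    ((volume : Measure (Space n))[|Metric.ball x ε]) (Metric.ball z r)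
      = ENNReal.ofReal ((r / ε) ^ n) := by
  have hvol : (volume : Measure (Space n)) (Metric.ball z r)
      = ENNReal.ofReal ((r / ε) ^ n) * volume (Metric.ball x ε) := by
    conv_lhs => rw [← div_mul_cancel₀ r hε.ne']
    rw [Measure.addHaar_ball_mul_of_pos _ _ (by positivity), Measure.addHaar_ball_center _ x]
    simp
  rw [cond_apply measurableSet_ball, Set.inter_eq_right.2 hsub, hvol, mul_left_comm,
    ENNReal.inv_mul_cancel (Metric.measure_ball_pos volume x hε).ne' measure_ball_lt_top.ne,
    mul_one]

lemma le_stepMeasure_ball (hp : 2 < p) {z : Space n} {r : ℝ} (hr : 0 < r)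
    (hε : 0 < ε) (hsub : Metric.ball z r ⊆ Metric.ball x ε) :
    coinBeta n p * (r / ε) ^ n ≤ (stepMeasure p ε x σ).real (Metric.ball z r) := by
  have := isProbabilityMeasure_stepMeasure hp hε x σ
  refine (ENNReal.ofReal_le_iff_le_toReal (measure_ne_top _ _)).1 ?_
  rw [ENNReal.ofReal_mul (coinBeta_pos n (by linarith)).le, ← cond_ball_apply_ball hr hε hsub,
    stepMeasure, add_assoc, Measure.add_apply, Measure.smul_apply, smul_eq_mul]
  exact le_self_add

/-- A lower bound for the variance, relative to `ε ^ 2`, of a step in any direction. -/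
noncomputable def ellipticity (n : ℕ) (p : ℝ) : ℝ := coinBeta n p * (1 / 4) ^ n / 16

lemma ellipticity_pos (n : ℕ) (hp : 0 < p) : 0 < ellipticity n p := by
  have := coinBeta_pos n hp
  unfold ellipticity
  positivity

lemma le_inner_of_mem_ball {E : Type*} [NormedAddCommGroup E] [InnerProductSpace ℝ E]
    {v x y : E} {ε : ℝ} (hv : v ≠ 0)
    (hy : y ∈ Metric.ball (x + (ε / 2 / ‖v‖) • v) (ε / 4)) :
    ε * ‖v‖ / 4 ≤ inner ℝ v (y - x) := by
  have hv' : 0 < ‖v‖ := norm_pos_iff.2 hv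
  rw [mem_ball_iff_norm] at hy
  have hdecomp : inner ℝ v (y - x)
      = ε / 2 * ‖v‖ + inner ℝ v (y - (x + (ε / 2 / ‖v‖) • v)) := by
    rw [← sub_sub, inner_sub_right v (y - x), real_inner_smul_right, real_inner_self_eq_norm_sq]
    field_simp
    ring
  have herr : |inner ℝ v (y - (x + (ε / 2 / ‖v‖) • v))| ≤ ‖v‖ * (ε / 4) :=
    (abs_real_inner_le_norm _ _).trans (by gcongr)
  linarith [(abs_le.1 herr).1]

lemma ellipticity_mul_le_integral_inner_sq (hp : 2 < p) (hε : 0 < ε) (hσ : ‖σ‖ = 1)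
    (v : Space n) :
    ellipticity n p * ε ^ 2 * ‖v‖ ^ 2 ≤ ∫ y, inner ℝ v (y - x) ^ 2 ∂(stepMeasure p ε x σ) := by
  have := isProbabilityMeasure_stepMeasure hp hε x σ
  rcases eq_or_ne v 0 with rfl | hv
  · simp
  set z : Space n := x + (ε / 2 / ‖v‖) • v
  have hsub : Metric.ball z (ε / 4) ⊆ Metric.ball x ε := by
    refine Metric.ball_subset_ball' ?_
    rw [dist_eq_norm, add_sub_cancel_left, norm_smul, Real.norm_of_nonneg (by positivity),
      div_mul_cancel₀ _ (norm_ne_zero_iff.2 hv)]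
    linarith
  have hlarge : Metric.ball z (ε / 4) ⊆ {y | (ε * ‖v‖ / 4) ^ 2 ≤ inner ℝ v (y - x) ^ 2} :=
    fun y hy => pow_le_pow_left₀ (by positivity) (le_inner_of_mem_ball hv hy) 2
  calc ellipticity n p * ε ^ 2 * ‖v‖ ^ 2
      = (ε * ‖v‖ / 4) ^ 2 * (coinBeta n p * (ε / 4 / ε) ^ n) := by
        rw [ellipticity, div_right_comm, div_self hε.ne']
        ring
    _ ≤ (ε * ‖v‖ / 4) ^ 2 * (stepMeasure p ε x σ).real (Metric.ball z (ε / 4)) := by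
        gcongr
        exact le_stepMeasure_ball hp (by positivity) hε hsub
    _ ≤ (ε * ‖v‖ / 4) ^ 2
        * (stepMeasure p ε x σ).real {y | (ε * ‖v‖ / 4) ^ 2 ≤ inner ℝ v (y - x) ^ 2} :=
        mul_le_mul_of_nonneg_left (measureReal_mono hlarge) (sq_nonneg _)
    _ ≤ _ := mul_meas_ge_le_integral_of_nonneg (ae_of_all _ fun y => sq_nonneg _)
        ((isSymmetricStep_stepMeasure hε.le hσ).integrable_of_continuous (by fun_prop)) _

end StepMeasure

section Barrier

open scoped NNReal

/-- The centres of the balls of radius `δ` that do not meet `Ω`. -/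
def exteriorCenters {X : Type*} [PseudoMetricSpace X] (Ω : Set X) (δ : ℝ) : Set X :=
  {z | Metric.ball z δ ⊆ Ωᶜ}

/-- The exterior ball condition with radius `δ`. Unlike in the exterior sphere condition, the
closed balls may touch `Ω` at several points. -/
def HasExteriorBalls {X : Type*} [PseudoMetricSpace X] (Ω : Set X) (δ : ℝ) : Prop :=
  ∀ y ∈ frontier Ω, ∃ z ∈ exteriorCenters Ω δ, y ∈ Metric.closedBall z δ

section Metric

variable {X : Type*} [PseudoMetricSpace X] {Ω : Set X} {δ : ℝ}

lemma mem_exteriorCenters_iff {z : X} : z ∈ exteriorCenters Ω δ ↔ ∀ x ∈ Ω, δ ≤ dist x z :=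
  ⟨fun h _ hx => not_lt.1 fun hlt => h (Metric.mem_ball.2 hlt) hx,
    fun h _ hball hx => (h _ hx).not_gt (Metric.mem_ball.1 hball)⟩

lemma isClosed_exteriorCenters : IsClosed (exteriorCenters Ω δ) := by
  have h : exteriorCenters Ω δ = ⋂ x ∈ Ω, {z | δ ≤ dist x z} := by
    ext z
    simp only [mem_exteriorCenters_iff, Set.mem_iInter₂, Set.mem_ofPred_eq]
  rw [h]
  exact isClosed_biInter fun x _ => isClosed_le continuous_const (by fun_prop)

lemma le_infDist_exteriorCenters (hne : (exteriorCenters Ω δ).Nonempty) {x : X}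
    (hx : x ∈ closure Ω) : δ ≤ Metric.infDist x (exteriorCenters Ω δ) := by
  have hclosed : IsClosed {x | δ ≤ Metric.infDist x (exteriorCenters Ω δ)} :=
    isClosed_le continuous_const (Metric.continuous_infDist_pt _)
  exact closure_minimal (fun x hx => (Metric.le_infDist hne).2 fun z hz =>
    mem_exteriorCenters_iff.1 hz x hx) hclosed hx

lemma HasExteriorBalls.infDist_exteriorCenters_eq (hΩ : HasExteriorBalls Ω δ) {y : X}
    (hy : y ∈ frontier Ω) : Metric.infDist y (exteriorCenters Ω δ) = δ := by
  obtain ⟨z, hz, hyz⟩ := hΩ y hy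
  exact le_antisymm ((Metric.infDist_le_dist_of_mem hz).trans hyz)
    (le_infDist_exteriorCenters ⟨z, hz⟩ (frontier_subset_closure hy))

end Metric

lemma nonempty_frontier_of_isBounded {E : Type*} [NormedAddCommGroup E] [NormedSpace ℝ E]
    [Nontrivial E] {Ω : Set E} (hne : Ω.Nonempty) (hb : Bornology.IsBounded Ω) :
    (frontier Ω).Nonempty := by
  refine nonempty_frontier_iff.2 ⟨hne, ?_⟩
  rintro rfl
  exact NormedSpace.unbounded_univ ℝ E hb

lemma nontrivial_space {n : ℕ} (hn : 1 ≤ n) : Nontrivial (Space n) := by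
  have : Nonempty (Fin n) := ⟨⟨0, hn⟩⟩
  infer_instance

lemma lipschitzWith_exp_neg_mul_sq (lam : ℝ≥0) :
    LipschitzWith (1 + lam) fun s : ℝ => Real.exp (-lam * s ^ 2) := by
  have hderiv (s : ℝ) : HasDerivAt (fun s : ℝ => Real.exp (-lam * s ^ 2))
      (Real.exp (-lam * s ^ 2) * (-lam * (2 * s))) s := by
    simpa using ((hasDerivAt_pow 2 s).const_mul (-lam : ℝ)).exp
  refine lipschitzWith_of_nnnorm_deriv_le (fun s => (hderiv s).differentiableAt) fun s => ?_
  have hlam : (0 : ℝ) ≤ lam := lam.2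
  have hexp : Real.exp (-lam * s ^ 2) * (1 + lam * s ^ 2) ≤ 1 := by
    rw [neg_mul, Real.exp_neg, inv_mul_le_one₀ (Real.exp_pos _), add_comm]
    exact Real.add_one_le_exp _
  have hlin : |-lam * (2 * s)| ≤ (1 + lam) * (1 + lam * s ^ 2) := by
    have hsq : 0 ≤ (lam : ℝ) ^ 2 * s ^ 2 := by positivity
    rw [abs_le]
    constructor <;> nlinarith [mul_nonneg hlam (sq_nonneg (s - 1)),
      mul_nonneg hlam (sq_nonneg (s + 1))]
  rw [← NNReal.coe_le_coe, coe_nnnorm, (hderiv s).deriv, Real.norm_eq_abs, abs_mul, Real.abs_exp]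
  calc Real.exp (-lam * s ^ 2) * |-lam * (2 * s)|
      ≤ Real.exp (-lam * s ^ 2) * ((1 + lam) * (1 + lam * s ^ 2)) := by gcongr
    _ = (1 + lam) * (Real.exp (-lam * s ^ 2) * (1 + lam * s ^ 2)) := by ring
    _ ≤ (1 + lam) * 1 := by gcongr
    _ = (1 + lam : ℝ≥0) := by simp

lemma lipschitzWith_exp_neg_mul_infDist_sq {X : Type*} [PseudoMetricSpace X] (lam : ℝ≥0)
    (Z : Set X) : LipschitzWith (1 + lam) fun x => Real.exp (-lam * Metric.infDist x Z ^ 2) := by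
  simpa only [mul_one, Function.comp_def] using
    (lipschitzWith_exp_neg_mul_sq lam).comp (Metric.lipschitz_infDist_pt Z)

variable {n : ℕ} {p ε : ℝ} {Ω : Set (Space n)}

lemma le_integral_gaussian_stepMeasure (hp : 2 < p) (hε : 0 < ε) {x σ z : Space n}
    (hσ : ‖σ‖ = 1) {lam : ℝ} (hlam : 0 ≤ lam) (hlamε : lam * ε ^ 2 ≤ 1 / 2)
    (hlamz : 2 ≤ lam * (ellipticity n p * ‖x - z‖ ^ 2)) :
    Real.exp (-lam * ‖x - z‖ ^ 2) * (1 + lam * ε ^ 2)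
      ≤ ∫ y, Real.exp (-lam * ‖y - z‖ ^ 2) ∂(stepMeasure p ε x σ) := by
  have := isProbabilityMeasure_stepMeasure hp hε x σ
  refine le_trans ?_ ((isSymmetricStep_stepMeasure hε.le hσ).le_integral_gaussian hlam z)
  have hvar := ellipticity_mul_le_integral_inner_sq (x := x) hp hε hσ (x - z)
  have hgain : 4 * (lam * ε ^ 2)
      ≤ 2 * lam ^ 2 * ∫ y, inner ℝ (x - z) (y - x) ^ 2 ∂(stepMeasure p ε x σ) :=
    calc 4 * (lam * ε ^ 2) = 2 * (lam * ε ^ 2) * 2 := by ring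
      _ ≤ 2 * (lam * ε ^ 2) * (lam * (ellipticity n p * ‖x - z‖ ^ 2)) := by gcongr
      _ = 2 * lam ^ 2 * (ellipticity n p * ε ^ 2 * ‖x - z‖ ^ 2) := by ring
      _ ≤ _ := by gcongr
  have hnonneg : 0 ≤ lam * ε ^ 2 := by positivity
  gcongr
  nlinarith

lemma le_integral_exp_neg_mul_infDist_sq (hp : 2 < p) (hε : 0 < ε) {x σ : Space n}
    (hσ : ‖σ‖ = 1) {lam : ℝ≥0} (hlamε : lam * ε ^ 2 ≤ 1 / 2) {Z : Set (Space n)}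
    (hZ : IsClosed Z) (hne : Z.Nonempty)
    (hlamZ : 2 ≤ lam * (ellipticity n p * Metric.infDist x Z ^ 2)) :
    Real.exp (-lam * Metric.infDist x Z ^ 2) * (1 + lam * ε ^ 2)
      ≤ ∫ y, Real.exp (-lam * Metric.infDist y Z ^ 2) ∂(stepMeasure p ε x σ) := by
  have := isProbabilityMeasure_stepMeasure hp hε x σ
  have hstep := isSymmetricStep_stepMeasure (p := p) (x := x) hε.le hσ
  obtain ⟨z, hz, hxz⟩ := hZ.exists_infDist_eq_dist hne x
  rw [dist_eq_norm] at hxz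
  rw [hxz] at hlamZ ⊢
  refine (le_integral_gaussian_stepMeasure hp hε hσ lam.coe_nonneg hlamε hlamZ).trans ?_
  refine integral_mono (hstep.integrable_of_continuous (by fun_prop))
    (hstep.integrable_of_continuous (lipschitzWith_exp_neg_mul_infDist_sq lam Z).continuous)
    fun y => ?_
  have hyz := Metric.infDist_le_dist_of_mem (x := y) hz
  have hnonneg : 0 ≤ Metric.infDist y Z := Metric.infDist_nonneg
  rw [dist_eq_norm] at hyz
  simp only [neg_mul]
  gcongr

/-- A barrier for `Ω` is a Lipschitz function that is nonpositive in `Ω`, vanishes on the boundary,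
and increases in mean by at least `ε ^ 2` in each step of length `ε < ε₁` from a point of `Ω`,
whatever direction the controller chooses. -/
structure IsBarrier (p : ℝ) (Ω : Set (Space n)) (G : Space n → ℝ) (L : ℝ≥0) (ε₁ : ℝ) : Prop where
  lipschitzWith : LipschitzWith L G
  nonpos_of_mem : ∀ x ∈ Ω, G x ≤ 0
  eq_zero_of_mem_frontier : ∀ x ∈ frontier Ω, G x = 0
  drift : ∀ ε, 0 < ε → ε < ε₁ → ∀ x ∈ Ω, ∀ σ : Space n, ‖σ‖ = 1 →
    G x + ε ^ 2 ≤ ∫ y, G y ∂(stepMeasure p ε x σ)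

lemma exists_forall_mul_sq_le_half {lam : ℝ} (hlam : 0 < lam) :
    ∃ ε₁ > 0, ∀ ε, 0 < ε → ε < ε₁ → lam * ε ^ 2 ≤ 1 / 2 := by
  refine ⟨Real.sqrt (1 / (2 * lam)), by positivity, fun ε hε hlt => ?_⟩
  have hsq := ((Real.lt_sqrt hε.le).1 hlt).le
  rw [le_div_iff₀ (by positivity)] at hsq
  linarith

lemma exists_isBarrier_of_drift (hp : 2 < p) {g : Space n → ℝ} {b c ε₁ : ℝ} {K : ℝ≥0} (hc : 0 < c)
    (hg : LipschitzWith K g) (hle : ∀ x ∈ Ω, g x ≤ b) (heq : ∀ x ∈ frontier Ω, g x = b)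
    (hdrift : ∀ ε, 0 < ε → ε < ε₁ → ∀ x ∈ Ω, ∀ σ : Space n, ‖σ‖ = 1 →
      g x + c * ε ^ 2 ≤ ∫ y, g y ∂(stepMeasure p ε x σ)) :
    ∃ (G : Space n → ℝ) (L : ℝ≥0), IsBarrier p Ω G L ε₁ := by
  refine ⟨fun x => c⁻¹ * (g x - b), _,
    (lipschitzWith_smul c⁻¹).comp (hg.sub (LipschitzWith.const b)),
    fun x hx => ?_, fun x hx => ?_, fun ε hε hlt x hx σ hσ => ?_⟩
  · exact mul_nonpos_of_nonneg_of_nonpos (by positivity) (sub_nonpos.2 (hle x hx))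
  · rw [heq x hx, sub_self, mul_zero]
  · have := isProbabilityMeasure_stepMeasure hp hε x σ
    rw [integral_const_mul, integral_sub ((isSymmetricStep_stepMeasure
      hε.le hσ).integrable_of_continuous hg.continuous) (integrable_const _), integral_const,
      probReal_univ, one_smul]
    calc c⁻¹ * (g x - b) + ε ^ 2 = c⁻¹ * (g x + c * ε ^ 2 - b) := by field_simp; ring
      _ ≤ _ := by gcongr; exact hdrift ε hε hlt x hx σ hσ

lemma exists_isBarrier [Nontrivial (Space n)] (hp : 2 < p) (hne : Ω.Nonempty)
    (hb : Bornology.IsBounded Ω) {δ : ℝ} (hδ : 0 < δ) (hext : HasExteriorBalls Ω δ) :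
    ∃ ε₁ > 0, ∃ (G : Space n → ℝ) (L : ℝ≥0), IsBarrier p Ω G L ε₁ := by
  obtain ⟨y₀, hy₀⟩ := nonempty_frontier_of_isBounded hne hb
  obtain ⟨z₀, hz₀, -⟩ := hext y₀ hy₀
  obtain ⟨R, hR⟩ := (Metric.isBounded_iff_subset_closedBall z₀).1 hb
  have hκ := ellipticity_pos n (p := p) (by linarith)
  obtain ⟨lam, hlam_pos, hlam⟩ : ∃ lam : ℝ≥0, 0 < lam ∧ 2 ≤ lam * (ellipticity n p * δ ^ 2) := by
    have hpos : 0 < 2 / (ellipticity n p * δ ^ 2) := by positivity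
    exact ⟨⟨_, hpos.le⟩, hpos, (div_mul_cancel₀ _ (by positivity)).ge⟩
  obtain ⟨ε₁, hε₁, hlamε⟩ := exists_forall_mul_sq_le_half (NNReal.coe_pos.2 hlam_pos)
  set Z := exteriorCenters Ω δ
  have hδZ : ∀ x ∈ Ω, δ ≤ Metric.infDist x Z := fun x hx =>
    le_infDist_exteriorCenters ⟨z₀, hz₀⟩ (subset_closure hx)
  refine ⟨ε₁, hε₁, exists_isBarrier_of_drift (Ω := Ω) (b := Real.exp (-lam * δ ^ 2))
    (c := lam * Real.exp (-lam * R ^ 2)) (ε₁ := ε₁) hp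
    (mul_pos (NNReal.coe_pos.2 hlam_pos) (Real.exp_pos _))
    (lipschitzWith_exp_neg_mul_infDist_sq lam Z) (fun x hx => ?_) (fun x hx => ?_)
    fun ε hε hlt x hx σ hσ => ?_⟩
  · have := hδZ x hx
    simp only [neg_mul]
    gcongr
  · simp only [Z, hext.infDist_exteriorCenters_eq hx]
  · have hxR : Metric.infDist x Z ≤ R := (Metric.infDist_le_dist_of_mem hz₀).trans (hR hx)
    have hexp : Real.exp (-lam * R ^ 2) ≤ Real.exp (-lam * Metric.infDist x Z ^ 2) := by
      have : 0 ≤ Metric.infDist x Z := Metric.infDist_nonneg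
      simp only [neg_mul]
      gcongr
    calc Real.exp (-lam * Metric.infDist x Z ^ 2) + lam * Real.exp (-lam * R ^ 2) * ε ^ 2
        ≤ Real.exp (-lam * Metric.infDist x Z ^ 2)
          + lam * Real.exp (-lam * Metric.infDist x Z ^ 2) * ε ^ 2 := by gcongr
      _ = Real.exp (-lam * Metric.infDist x Z ^ 2) * (1 + lam * ε ^ 2) := by ring
      _ ≤ _ := le_integral_exp_neg_mul_infDist_sq hp hε hσ (hlamε ε hε hlt)
          isClosed_exteriorCenters ⟨z₀, hz₀⟩ (hlam.trans (by gcongr; exact hδZ x hx))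

end Barrier

section Trajectories

open Finset Preorder Kernel

variable {X : ℕ → Type*} [∀ n, MeasurableSpace (X n)]
  {κ : (n : ℕ) → Kernel (Π i : Iic n, X i) (X (n + 1))} [∀ n, IsMarkovKernel (κ n)]
  {a : ℕ} {x₀ : Π i : Iic a, X i}

lemma ae_traj_succ {k : ℕ} (hak : a ≤ k) {P : (Π i : Iic k, X i) → X (k + 1) → Prop}
    (hP : MeasurableSet {q : (Π i : Iic k, X i) × X (k + 1) | P q.1 q.2})
    (h : ∀ x, ∀ᵐ y ∂κ k x, P x y) :
    ∀ᵐ ω ∂traj κ a x₀, P (frestrictLe k ω) (ω (k + 1)) := by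
  have hae : ∀ᵐ q ∂(traj κ a x₀).map (fun ω => (frestrictLe k ω, ω (k + 1))), P q.1 q.2 := by
    rw [← partialTraj_compProd_eq_map_traj hak, Measure.ae_compProd_iff hP]
    exact ae_of_all _ h
  exact ae_of_ae_map (by fun_prop) hae

lemma integral_traj_eq_integral_update {k : ℕ} {Z : (Π n, X n) → ℝ} (hZ : Measurable Z)
    (hdep : DependsOn Z (Set.Iic (k + 1))) (x : Π n, X n) :
    ∫ ω, Z ω ∂traj κ k (frestrictLe k x)
      = ∫ y, Z (Function.update x (k + 1) y) ∂κ k (frestrictLe k x) := by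
  have hupdate (ω : Π n, X n) : Z (Function.updateFinset ω (Iic k) (frestrictLe k x))
      = Z (Function.update x (k + 1) (ω (k + 1))) := by
    refine hdep fun i hi => ?_
    rcases (Set.mem_Iic.1 hi).lt_or_eq with hlt | rfl
    · simp [Function.updateFinset, Nat.lt_succ_iff.1 hlt, Function.update_of_ne hlt.ne]
    · simp [Function.updateFinset]
  have hZupdate : Measurable fun y => Z (Function.update x (k + 1) y) :=
    hZ.comp (measurable_update x)
  rw [integral_traj _ hZ.aestronglyMeasurable, ← map_traj_succ_self (κ := κ) (a := k),
    Kernel.map_apply _ (by fun_prop),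
    integral_map (measurable_pi_apply _).aemeasurable hZupdate.aestronglyMeasurable]
  simp only [hupdate]

lemma integral_traj_succ {k : ℕ} (hak : a ≤ k) {Z : (Π n, X n) → ℝ} (hZ : Measurable Z)
    (hint : Integrable Z (traj κ a x₀)) (hdep : DependsOn Z (Set.Iic (k + 1))) :
    ∫ ω, Z ω ∂traj κ a x₀
      = ∫ ω, ∫ y, Z (Function.update ω (k + 1) y) ∂κ k (frestrictLe k ω) ∂traj κ a x₀ := by
  rw [← integral_traj_partialTraj hak hint, ← traj_map_frestrictLe_apply,
    integral_map (by fun_prop) hZ.stronglyMeasurable.integral_kernel.aestronglyMeasurable]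
  simp only [integral_traj_eq_integral_update hZ hdep]

lemma integral_traj_le_integral_succ {k : ℕ} (hak : a ≤ k) {Y Z : (Π n, X n) → ℝ}
    (hY : Measurable Y) (hYint : Integrable Y (traj κ a x₀)) (hYdep : DependsOn Y (Set.Iic k))
    (hZ : Measurable Z) (hZint : Integrable Z (traj κ a x₀))
    (hZdep : DependsOn Z (Set.Iic (k + 1)))
    (hdrift : ∀ ω, 0 ≤ ∫ y, (Z (Function.update ω (k + 1) y) - Y ω) ∂κ k (frestrictLe k ω)) :
    ∫ ω, Y ω ∂traj κ a x₀ ≤ ∫ ω, Z ω ∂traj κ a x₀ := by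
  have hYupdate (ω : Π n, X n) (y : X (k + 1)) : Y (Function.update ω (k + 1) y) = Y ω :=
    hYdep fun i hi => Function.update_of_ne (Nat.lt_succ_of_le (Set.mem_Iic.1 hi)).ne _ _
  have hdep : DependsOn (fun ω => Z ω - Y ω) (Set.Iic (k + 1)) := fun ω ω' h => by
    beta_reduce
    rw [hZdep h, hYdep fun i hi => h i (Set.Iic_subset_Iic.2 k.le_succ hi)]
  rw [← sub_nonneg, ← integral_sub hZint hYint,
    integral_traj_succ hak (Z := fun ω => Z ω - Y ω) (hZ.sub hY) (hZint.sub hYint) hdep]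
  refine integral_nonneg fun ω => (?_ : (0 : ℝ) ≤ _)
  simpa only [hYupdate] using hdrift ω

lemma map_frestrictLe_succ_eq_of_map_prodMk_eq {μ ν : Measure (Π n, X n)} {k : ℕ}
    (h : μ.map (fun ω => (frestrictLe k ω, ω (k + 1)))
      = ν.map (fun ω => (frestrictLe k ω, ω (k + 1)))) :
    μ.map (frestrictLe (k + 1)) = ν.map (frestrictLe (k + 1)) := by
  set glue : (Π i : Iic k, X i) × X (k + 1) → Π i : Iic (k + 1), X i :=
    fun q => IicProdIoc k (k + 1) (q.1, MeasurableEquiv.piSingleton k q.2)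
  have hglue : Measurable glue := by fun_prop
  have hcomp : frestrictLe (k + 1) = glue ∘ fun ω : Π n, X n => (frestrictLe k ω, ω (k + 1)) := by
    ext ω i
    rcases (Finset.mem_Iic.1 i.2).lt_or_eq with hlt | heq
    · simp [glue, IicProdIoc_def, Nat.lt_succ_iff.1 hlt]
    · obtain ⟨i, hi⟩ := i
      obtain rfl : i = k + 1 := heq
      simp [glue, IicProdIoc_def, MeasurableEquiv.piSingleton]
  rw [hcomp, ← Measure.map_map hglue (by fun_prop), h, Measure.map_map hglue (by fun_prop)]

lemma eq_traj_of_map_prodMk_eq {ν : Measure (Π n, X n)}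
    (h₀ : ν.map (frestrictLe a) = Measure.dirac x₀)
    (hsucc : ∀ k, a ≤ k → ν.map (fun ω => (frestrictLe k ω, ω (k + 1)))
      = ν.map (frestrictLe k) ⊗ₘ κ k) :
    ν = traj κ a x₀ := by
  have hmap (k : ℕ) (hak : a ≤ k) : ν.map (frestrictLe k) = partialTraj κ a k x₀ := by
    induction k, hak using Nat.le_induction with
    | base => rw [h₀, partialTraj_self, Kernel.id_apply]
    | succ k hak ih =>
      rw [← traj_map_frestrictLe_apply]
      refine map_frestrictLe_succ_eq_of_map_prodMk_eq ?_
      rw [hsucc k hak, ih, partialTraj_compProd_eq_map_traj hak]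
  refine IsProjectiveLimit.unique ?_ (isProjectiveLimit_trajFun κ a x₀)
  refine (isProjectiveLimit_nat_iff' (isProjectiveMeasureFamily_partialTraj κ x₀) ν a).2
    fun k hak => ?_
  rw [inducedFamily_Iic, hmap k hak]

lemma map_prodMap_compProd {A A' B B' : Type*} [MeasurableSpace A] [MeasurableSpace A']
    [MeasurableSpace B] [MeasurableSpace B'] {μ : Measure A} [SFinite μ] {κ : Kernel A B}
    [IsSFiniteKernel κ] {η : Kernel A' B'} [IsSFiniteKernel η] {f : A → A'} {g : B → B'}
    (hf : Measurable f) (hg : Measurable g) (h : ∀ x, (κ x).map g = η (f x)) :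
    (μ ⊗ₘ κ).map (Prod.map f g) = μ.map f ⊗ₘ η := by
  ext s hs
  rw [Measure.map_apply (hf.prodMap hg) hs, Measure.compProd_apply (hf.prodMap hg hs),
    Measure.compProd_apply hs, MeasureTheory.lintegral_map
      (Kernel.measurable_kernel_prodMk_left hs) hf]
  refine lintegral_congr fun x => ?_
  rw [← h x, Measure.map_apply hg (measurable_prodMk_left hs)]
  rfl

variable {Y : ℕ → Type*} [∀ n, MeasurableSpace (Y n)]
  {η : (n : ℕ) → Kernel (Π i : Iic n, Y i) (Y (n + 1))} [∀ n, IsMarkovKernel (η n)]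

lemma map_traj_of_intertwining {e : (n : ℕ) → X n → Y n} (he : ∀ n, Measurable (e n))
    (h : ∀ n x, (κ n x).map (e (n + 1)) = η n (fun i => e i (x i))) :
    (traj κ a x₀).map (fun ω n => e n (ω n)) = traj η a (fun i => e i (x₀ i)) := by
  have hpi (k : ℕ) : Measurable fun (x : Π i : Iic k, X i) (i : Iic k) => e i (x i) := by
    fun_prop
  have hmap (k : ℕ) : ((traj κ a x₀).map (fun ω n => e n (ω n))).map (frestrictLe k)
      = (partialTraj κ a k x₀).map
        (fun (x : Π i : Iic k, X i) (i : Iic k) => e i (x i)) := by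
    rw [← traj_map_frestrictLe_apply, Measure.map_map (by fun_prop) (by fun_prop),
      Measure.map_map (hpi k) (by fun_prop)]
    rfl
  refine eq_traj_of_map_prodMk_eq ?_ fun k hak => ?_
  · rw [hmap, partialTraj_self, Kernel.id_apply, Measure.map_dirac' (hpi a)]
  · rw [hmap, ← map_prodMap_compProd (hpi k) (he (k + 1)) (h k),
      partialTraj_compProd_eq_map_traj hak, Measure.map_map (by fun_prop) (by fun_prop),
      Measure.map_map ((hpi k).prodMap (he _)) (by fun_prop)]
    rfl

end Trajectories

section StoppingRounds

/-- A stopping time of the canonical filtration of a path space, with values in `ℕ`. Adaptedness is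
expressed pathwise: whether the path is stopped after round `k` depends on the rounds up to `k`. -/
structure IsStoppingRound {X : ℕ → Type*} [∀ n, MeasurableSpace (X n)] (τ : (Π n, X n) → ℕ) :
    Prop where
  measurable : Measurable τ
  dependsOn_lt : ∀ k, DependsOn (fun ω => k < τ ω) (Set.Iic k)

namespace IsStoppingRound

variable {X : ℕ → Type*} [∀ n, MeasurableSpace (X n)] {σ τ : (Π n, X n) → ℕ}

lemma min (hσ : IsStoppingRound σ) (hτ : IsStoppingRound τ) :
    IsStoppingRound fun ω => min (σ ω) (τ ω) where
  measurable := hσ.measurable.min hτ.measurable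
  dependsOn_lt k ω ω' h := by
    simpa only [lt_min_iff] using congrArg₂ And (hσ.dependsOn_lt k h) (hτ.dependsOn_lt k h)

lemma max (hσ : IsStoppingRound σ) (hτ : IsStoppingRound τ) :
    IsStoppingRound fun ω => max (σ ω) (τ ω) where
  measurable := hσ.measurable.max hτ.measurable
  dependsOn_lt k ω ω' h := by
    simpa only [lt_max_iff] using congrArg₂ Or (hσ.dependsOn_lt k h) (hτ.dependsOn_lt k h)

lemma comp_map {Y : ℕ → Type*} [∀ n, MeasurableSpace (Y n)] (hτ : IsStoppingRound τ)
    {e : (n : ℕ) → Y n → X n} (he : ∀ n, Measurable (e n)) :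
    IsStoppingRound fun ω : Π n, Y n => τ fun n => e n (ω n) where
  measurable := hτ.measurable.comp (by fun_prop)
  dependsOn_lt k _ _ h := hτ.dependsOn_lt k fun i hi => congrArg (e i) (h i hi)

lemma min_eq_min (hτ : IsStoppingRound τ) {k m : ℕ} (hm : m ≤ k + 1) {ω ω' : Π n, X n}
    (h : ∀ i ∈ Set.Iic k, ω i = ω' i) : Min.min m (τ ω) = Min.min m (τ ω') := by
  refine eq_of_forall_lt_iff fun j => ?_
  rw [lt_min_iff, lt_min_iff]
  refine and_congr_right fun hj => (hτ.dependsOn_lt j fun i hi => h i ?_).to_iff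
  exact (Set.mem_Iic.1 hi).trans (Nat.lt_succ_iff.1 (hj.trans_le hm))

end IsStoppingRound

variable {E : Type*} {A : Set E} {K k : ℕ} {ω : ℕ → E}

/-- The first round in which the path `ω` is outside `A`, capped at `K`. -/
noncomputable def exitRound (A : Set E) (K : ℕ) (ω : ℕ → E) : ℕ :=
  sInf {k | ω k ∉ A ∨ K ≤ k}

lemma exitRound_le : exitRound A K ω ≤ K := Nat.sInf_le (Or.inr le_rfl)

lemma notMem_or_le_exitRound : ω (exitRound A K ω) ∉ A ∨ K ≤ exitRound A K ω :=
  Nat.sInf_mem (s := {k | ω k ∉ A ∨ K ≤ k}) ⟨K, Or.inr le_rfl⟩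

lemma lt_exitRound_iff : k < exitRound A K ω ↔ ∀ j ≤ k, ω j ∈ A ∧ j < K := by
  refine ⟨fun h j hj => ?_, fun h => ?_⟩
  · simpa using Nat.notMem_of_lt_sInf (hj.trans_lt h)
  · by_contra! hle
    obtain ⟨hmem, hlt⟩ := h _ hle
    exact notMem_or_le_exitRound.elim (fun hnot => hnot hmem) fun hK => hlt.not_ge hK

lemma mem_of_lt_exitRound (h : k < exitRound A K ω) : ω k ∈ A :=
  (lt_exitRound_iff.1 h k le_rfl).1

lemma exitRound_le_add (A : Set E) (K K' : ℕ) (ω : ℕ → E) :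
    exitRound A K' ω ≤ exitRound A K ω + (K' - K) := by
  rcases notMem_or_le_exitRound (A := A) (K := K) (ω := ω) with hnot | hK
  · exact (Nat.sInf_le (Or.inl hnot)).trans le_self_add
  · exact exitRound_le.trans (by omega)

lemma abs_exitRound_sub_le {E : Type*} (A : Set E) (K K' : ℕ) (ω : ℕ → E) :
    |(exitRound A K ω : ℝ) - exitRound A K' ω| ≤ |(K : ℝ) - K'| := by
  have hle := exitRound_le_add A K K' ω
  have hge := exitRound_le_add A K' K ω
  have habs : |(exitRound A K ω : ℤ) - exitRound A K' ω| ≤ |(K : ℤ) - K'| := by grind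
  exact_mod_cast habs

lemma isStoppingRound_exitRound [MeasurableSpace E] (hA : MeasurableSet A) (K : ℕ) :
    IsStoppingRound (X := fun _ => E) (exitRound A K) where
  measurable := measurable_of_Ioi fun k => by
    have hset : exitRound A K ⁻¹' Set.Ioi k = ⋂ j, ⋂ (_ : j ≤ k), {ω | ω j ∈ A} ∩ {_ω | j < K} := by
      ext ω
      simp [lt_exitRound_iff]
    rw [hset]
    exact MeasurableSet.iInter fun j => MeasurableSet.iInter fun _ =>
      (measurable_pi_apply j hA).inter (MeasurableSet.const _)
  dependsOn_lt k ω ω' h := by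
    simp only [lt_exitRound_iff, eq_iff_iff]
    exact forall₂_congr fun j hj => by rw [h j hj]

end StoppingRounds

section SymmetricWalk

variable {E : Type*} [MeasurableSpace E]

/-- The law of the walk that starts at `x₀` and moves according to the kernels `κ`. -/
noncomputable def walkMeasure (κ : (n : ℕ) → Kernel (Finset.Iic n → E) E)
    [∀ n, IsMarkovKernel (κ n)] (x₀ : E) : Measure (ℕ → E) :=
  Kernel.traj (X := fun _ => E) κ 0 fun _ => x₀

instance (κ : (n : ℕ) → Kernel (Finset.Iic n → E) E) [∀ n, IsMarkovKernel (κ n)] (x₀ : E) :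
    IsProbabilityMeasure (walkMeasure κ x₀) := by
  unfold walkMeasure; infer_instance

lemma measurable_eval_comp {τ : (ℕ → E) → ℕ} (hτ : Measurable τ) :
    Measurable fun ω : ℕ → E => ω (τ ω) :=
  (measurable_from_prod_countable_right fun k => measurable_pi_apply k :
    Measurable fun q : ℕ × (ℕ → E) => q.2 q.1).comp (hτ.prodMk measurable_id)

variable [NormedAddCommGroup E]

/-- Every move of the walk with transition kernels `κ` is symmetric about the current position and
has length at most `ε`. -/
def IsSymmetricWalk (κ : (n : ℕ) → Kernel (Finset.Iic n → E) E) (ε : ℝ) : Prop :=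
  ∀ k h, IsSymmetricStep (κ k h) (h ⟨k, Finset.mem_Iic.2 le_rfl⟩) ε

/-- The path starts in the closure of `Ω` and moves by at most `ε` in each round. -/
structure IsAdmissiblePath (Ω : Set E) (ε : ℝ) (ω : ℕ → E) : Prop where
  zero_mem : ω 0 ∈ closure Ω
  norm_sub_le : ∀ k, ‖ω (k + 1) - ω k‖ ≤ ε

variable {κ : (n : ℕ) → Kernel (Finset.Iic n → E) E} [∀ n, IsMarkovKernel (κ n)] {x₀ : E}
  {ε : ℝ} [BorelSpace E] [ProperSpace E]

lemma ae_zero_eq_walkMeasure : ∀ᵐ ω ∂walkMeasure κ x₀, ω 0 = x₀ := by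
  have hae : ∀ᵐ h ∂(walkMeasure κ x₀).map (Preorder.frestrictLe (π := fun _ => E) 0),
      h ⟨0, Finset.mem_Iic.2 le_rfl⟩ = x₀ := by
    rw [walkMeasure, Kernel.traj_map_frestrictLe_apply, Kernel.partialTraj_self, Kernel.id_apply,
      ae_dirac_iff (measurableSet_eq_fun (measurable_pi_apply _) measurable_const)]
  exact ae_of_ae_map (by fun_prop) hae

lemma IsSymmetricWalk.ae_norm_sub_le (hκ : IsSymmetricWalk κ ε) :
    ∀ᵐ ω ∂walkMeasure κ x₀, ∀ k, ‖ω (k + 1) - ω k‖ ≤ ε := by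
  refine ae_all_iff.2 fun k => ae_traj_succ (X := fun _ => E) (Nat.zero_le k)
    (P := fun h y => ‖y - h ⟨k, Finset.mem_Iic.2 le_rfl⟩‖ ≤ ε) ?_ fun h => (hκ k h).ae_norm_sub_le
  exact (isClosed_le (by fun_prop) continuous_const).measurableSet

lemma IsSymmetricWalk.ae_isAdmissiblePath_add (hκ : IsSymmetricWalk κ ε) {Ω : Set E} {a : E}
    (hx₀ : x₀ + a ∈ closure Ω) :
    ∀ᵐ ω ∂walkMeasure κ x₀, IsAdmissiblePath Ω ε fun k => ω k + a := by
  filter_upwards [ae_zero_eq_walkMeasure, hκ.ae_norm_sub_le] with ω hzero hstep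
  exact ⟨by rwa [hzero], fun k => by rw [add_sub_add_right_eq_sub]; exact hstep k⟩

lemma IsSymmetricWalk.integrable_comp_eval (hκ : IsSymmetricWalk κ ε) {f : E → E → ℝ}
    (hf : Continuous (Function.uncurry f)) {σ τ : (ℕ → E) → ℕ} (hσ : Measurable σ)
    (hτ : Measurable τ) {N : ℕ} (hσN : ∀ ω, σ ω ≤ N) (hτN : ∀ ω, τ ω ≤ N) :
    Integrable (fun ω => f (ω (τ ω)) (ω (σ ω))) (walkMeasure κ x₀) := by
  have hball : ∀ᵐ ω ∂walkMeasure κ x₀, ∀ k ≤ N, ω k ∈ Metric.closedBall x₀ (N * ε) := by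
    filter_upwards [ae_zero_eq_walkMeasure, hκ.ae_norm_sub_le] with ω hzero hstep k hk
    have hdist := dist_le_range_sum_of_dist_le (f := ω) k (d := fun _ => ε) fun {j} _ => by
      rw [dist_eq_norm, norm_sub_rev]; exact hstep j
    rw [hzero, Finset.sum_const, Finset.card_range, nsmul_eq_mul, dist_comm] at hdist
    have hε : 0 ≤ ε := (norm_nonneg _).trans (hstep 0)
    exact hdist.trans (by gcongr)
  obtain ⟨C, hC⟩ := ((isCompact_closedBall x₀ (N * ε)).prod
    (isCompact_closedBall x₀ (N * ε))).exists_bound_of_continuousOn hf.continuousOn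
  refine Integrable.of_bound (hf.measurable.comp
    ((measurable_eval_comp hτ).prodMk (measurable_eval_comp hσ))).aestronglyMeasurable C ?_
  filter_upwards [hball] with ω hω
  exact hC (_, _) ⟨hω _ (hτN ω), hω _ (hσN ω)⟩

end SymmetricWalk

section Drift

lemma integrable_natCast_of_le {Ω' : Type*} [MeasurableSpace Ω'] {μ : Measure Ω'}
    [IsFiniteMeasure μ] {τ : Ω' → ℕ} (hτ : Measurable τ) {N : ℕ} (hτN : ∀ ω, τ ω ≤ N) :
    Integrable (fun ω => (τ ω : ℝ)) μ :=
  Integrable.of_bound (by fun_prop) N (ae_of_all _ fun ω => by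
    rw [Real.norm_natCast]
    exact_mod_cast hτN ω)

variable {E : Type*} {f : E → E → ℝ} {c : ℝ} {σ τ : (ℕ → E) → ℕ}

/-- The value after round `k` of the process that is zero until round `σ` and then, up to round
`τ`, is `f (ω k) (ω σ)` minus `c` for each round played since `σ`. It is a submartingale if `f`
increases by at least `c` in conditional mean between the rounds `σ` and `τ`. -/
def compensatedGain (f : E → E → ℝ) (c : ℝ) (σ τ : (ℕ → E) → ℕ) (k : ℕ) (ω : ℕ → E) : ℝ :=
  f (ω (min k (τ ω))) (ω (min k (σ ω))) - c * ((min k (τ ω) : ℕ) - (min k (σ ω) : ℕ))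

lemma compensatedGain_eq_zero (hf₀ : ∀ x, f x x = 0) {k : ℕ} {ω : ℕ → E} (hσ : k ≤ σ ω)
    (hτ : k ≤ τ ω) : compensatedGain f c σ τ k ω = 0 := by
  simp [compensatedGain, hσ, hτ, hf₀]

lemma compensatedGain_of_le {N : ℕ} {ω : ℕ → E} (hσ : σ ω ≤ N) (hτ : τ ω ≤ N) :
    compensatedGain f c σ τ N ω = f (ω (τ ω)) (ω (σ ω)) - c * (τ ω - σ ω) := by
  rw [compensatedGain, min_eq_right hσ, min_eq_right hτ]

variable [MeasurableSpace E]

lemma dependsOn_compensatedGain (hσ : IsStoppingRound (X := fun _ => E) σ)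
    (hτ : IsStoppingRound (X := fun _ => E) τ) (k : ℕ) :
    DependsOn (compensatedGain f c σ τ k) (Set.Iic k) := fun ω ω' h => by
  rw [compensatedGain, compensatedGain, ← hσ.min_eq_min k.le_succ h, ← hτ.min_eq_min k.le_succ h,
    h _ (Set.mem_Iic.2 (min_le_left _ _)), h _ (Set.mem_Iic.2 (min_le_left _ _))]

lemma compensatedGain_update_sub (hσ : IsStoppingRound (X := fun _ => E) σ)
    (hτ : IsStoppingRound (X := fun _ => E) τ) (hστ : ∀ ω, σ ω ≤ τ ω) (hf₀ : ∀ x, f x x = 0)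
    (k : ℕ) (ω : ℕ → E) (y : E) :
    compensatedGain f c σ τ (k + 1) (Function.update ω (k + 1) y) - compensatedGain f c σ τ k ω
      = if σ ω ≤ k ∧ k < τ ω then f y (ω (σ ω)) - (f (ω k) (ω (σ ω)) + c) else 0 := by
  have hupd (i : ℕ) (hi : i ∈ Set.Iic k) : Function.update ω (k + 1) y i = ω i :=
    Function.update_of_ne (Nat.lt_succ_of_le hi).ne _ _
  have hle := hστ ω
  rw [compensatedGain, compensatedGain, hσ.min_eq_min le_rfl hupd, hτ.min_eq_min le_rfl hupd]
  rcases lt_or_ge k (σ ω) with hkσ | hσk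
  · simp [hkσ.not_ge, hkσ.le, (hkσ.trans_le hle).le, Nat.succ_le_of_lt hkσ,
      Nat.succ_le_of_lt (hkσ.trans_le hle), hf₀]
  rcases lt_or_ge k (τ ω) with hkτ | hτk
  · rw [if_pos ⟨hσk, hkτ⟩, min_eq_left hkτ.le, min_eq_left (Nat.succ_le_of_lt hkτ),
      min_eq_right hσk, min_eq_right (hσk.trans k.le_succ), Function.update_self, hupd _ hσk]
    push_cast
    ring
  · rw [if_neg fun h => h.2.not_ge hτk, min_eq_right hτk, min_eq_right hσk,
      min_eq_right (hτk.trans k.le_succ), min_eq_right (hσk.trans k.le_succ), hupd _ hσk,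
      hupd _ hτk, sub_self]

variable [NormedAddCommGroup E] [BorelSpace E] [ProperSpace E]
  {κ : (n : ℕ) → Kernel (Finset.Iic n → E) E} [∀ n, IsMarkovKernel (κ n)] {x₀ : E} {ε : ℝ}

lemma measurable_compensatedGain (hf : Continuous (Function.uncurry f)) (hσ : Measurable σ)
    (hτ : Measurable τ) (k : ℕ) : Measurable (compensatedGain f c σ τ k) := by
  have heval : Measurable fun ω : ℕ → E => f (ω (min k (τ ω))) (ω (min k (σ ω))) :=
    hf.measurable.comp ((measurable_eval_comp (measurable_const.min hτ)).prodMk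
      (measurable_eval_comp (measurable_const.min hσ)))
  have hcast {ρ : (ℕ → E) → ℕ} (hρ : Measurable ρ) :
      Measurable fun ω => ((min k (ρ ω) : ℕ) : ℝ) := by
    have := measurable_const (a := k) |>.min hρ
    fun_prop
  exact heval.sub (((hcast hτ).sub (hcast hσ)).const_mul c)

lemma IsSymmetricWalk.integrable_compensatedGain (hκ : IsSymmetricWalk κ ε)
    (hf : Continuous (Function.uncurry f)) (hσ : Measurable σ) (hτ : Measurable τ) (k : ℕ) :
    Integrable (compensatedGain f c σ τ k) (walkMeasure κ x₀) := by
  have hσk := measurable_const (a := k) |>.min hσ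
  have hτk := measurable_const (a := k) |>.min hτ
  exact (hκ.integrable_comp_eval hf hσk hτk (fun _ => min_le_left _ _)
    fun _ => min_le_left _ _).sub (((integrable_natCast_of_le hτk fun _ => min_le_left _ _).sub
      (integrable_natCast_of_le hσk fun _ => min_le_left _ _)).const_mul c)

lemma IsSymmetricWalk.integral_compensatedGain_nonneg (hκ : IsSymmetricWalk κ ε)
    (hσ : IsStoppingRound (X := fun _ => E) σ) (hτ : IsStoppingRound (X := fun _ => E) τ)
    (hστ : ∀ ω, σ ω ≤ τ ω) (hf : Continuous (Function.uncurry f)) (hf₀ : ∀ x, f x x = 0)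
    (hdrift : ∀ k ω, σ ω ≤ k → k < τ ω → f (ω k) (ω (σ ω)) + c
      ≤ ∫ y, f y (ω (σ ω)) ∂κ k (Preorder.frestrictLe (π := fun _ => E) k ω)) (k : ℕ) :
    0 ≤ ∫ ω, compensatedGain f c σ τ k ω ∂walkMeasure κ x₀ := by
  induction k with
  | zero => simp [compensatedGain_eq_zero hf₀]
  | succ k ih =>
    refine ih.trans (integral_traj_le_integral_succ (X := fun _ => E) (Nat.zero_le k)
      (measurable_compensatedGain hf hσ.measurable hτ.measurable k)
      (hκ.integrable_compensatedGain hf hσ.measurable hτ.measurable k)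
      (dependsOn_compensatedGain hσ hτ k)
      (measurable_compensatedGain hf hσ.measurable hτ.measurable _)
      (hκ.integrable_compensatedGain hf hσ.measurable hτ.measurable _)
      (dependsOn_compensatedGain hσ hτ _) fun ω => ?_)
    simp only [compensatedGain_update_sub hσ hτ hστ hf₀]
    split_ifs with hk
    · rw [integral_sub ((hκ k _).integrable_of_continuous (by fun_prop)) (integrable_const _),
        integral_const, probReal_univ, one_smul, sub_nonneg]
      exact hdrift k ω hk.1 hk.2
    · simp

lemma IsSymmetricWalk.mul_integral_sub_le (hκ : IsSymmetricWalk κ ε)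
    (hσ : IsStoppingRound (X := fun _ => E) σ) (hτ : IsStoppingRound (X := fun _ => E) τ)
    (hστ : ∀ ω, σ ω ≤ τ ω) {N : ℕ} (hτN : ∀ ω, τ ω ≤ N)
    (hf : Continuous (Function.uncurry f)) (hf₀ : ∀ x, f x x = 0)
    (hdrift : ∀ k ω, σ ω ≤ k → k < τ ω → f (ω k) (ω (σ ω)) + c
      ≤ ∫ y, f y (ω (σ ω)) ∂κ k (Preorder.frestrictLe (π := fun _ => E) k ω)) :
    c * ∫ ω, ((τ ω : ℝ) - σ ω) ∂walkMeasure κ x₀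
      ≤ ∫ ω, f (ω (τ ω)) (ω (σ ω)) ∂walkMeasure κ x₀ := by
  have hσN ω : σ ω ≤ N := (hστ ω).trans (hτN ω)
  have hnonneg := hκ.integral_compensatedGain_nonneg (x₀ := x₀) hσ hτ hστ hf hf₀ hdrift N
  simp only [compensatedGain_of_le (hσN _) (hτN _)] at hnonneg
  have hint : Integrable (fun ω => c * ((τ ω : ℝ) - σ ω)) (walkMeasure κ x₀) :=
    ((integrable_natCast_of_le hτ.measurable hτN).sub
      (integrable_natCast_of_le hσ.measurable hσN)).const_mul c
  rwa [integral_sub (hκ.integrable_comp_eval hf hσ.measurable hτ.measurable hσN hτN) hint,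
    integral_const_mul, sub_nonneg] at hnonneg

end Drift

section SquaredDisplacement

variable {E : Type*} [NormedAddCommGroup E] [InnerProductSpace ℝ E] [MeasurableSpace E]
  [BorelSpace E] [ProperSpace E] {κ : (n : ℕ) → Kernel (Finset.Iic n → E) E}
  [∀ n, IsMarkovKernel (κ n)] {x₀ : E} {ε : ℝ} {σ τ : (ℕ → E) → ℕ}

lemma IsSymmetricWalk.integral_norm_sub_sq_le_of_le (hκ : IsSymmetricWalk κ ε)
    (hσ : IsStoppingRound (X := fun _ => E) σ) (hτ : IsStoppingRound (X := fun _ => E) τ)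
    (hστ : ∀ ω, σ ω ≤ τ ω) {N : ℕ} (hτN : ∀ ω, τ ω ≤ N) :
    ∫ ω, ‖ω (τ ω) - ω (σ ω)‖ ^ 2 ∂walkMeasure κ x₀
      ≤ ε ^ 2 * ∫ ω, ((τ ω : ℝ) - σ ω) ∂walkMeasure κ x₀ := by
  have h := hκ.mul_integral_sub_le (x₀ := x₀) hσ hτ hστ hτN (c := -ε ^ 2)
    (f := fun x a => -‖x - a‖ ^ 2) (by fun_prop) (by simp) fun k ω _ _ => by
      have := (hκ k (Preorder.frestrictLe (π := fun _ => E) k ω)).integral_norm_sub_sq_le (ω (σ ω))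
      rw [integral_neg]
      simp only [Preorder.frestrictLe_apply] at this
      linarith
  rw [integral_neg] at h
  linarith

lemma IsSymmetricWalk.integral_norm_sub_sq_le (hκ : IsSymmetricWalk κ ε)
    (hσ : IsStoppingRound (X := fun _ => E) σ) (hτ : IsStoppingRound (X := fun _ => E) τ)
    {N : ℕ} (hσN : ∀ ω, σ ω ≤ N) (hτN : ∀ ω, τ ω ≤ N) :
    ∫ ω, ‖ω (τ ω) - ω (σ ω)‖ ^ 2 ∂walkMeasure κ x₀
      ≤ ε ^ 2 * ∫ ω, |(τ ω : ℝ) - σ ω| ∂walkMeasure κ x₀ := by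
  have h := hκ.integral_norm_sub_sq_le_of_le (x₀ := x₀) (hσ.min hτ) (hσ.max hτ)
    (fun _ => min_le_max) fun ω => max_le (hσN ω) (hτN ω)
  have hnorm (ω : ℕ → E) : ‖ω (max (σ ω) (τ ω)) - ω (min (σ ω) (τ ω))‖ = ‖ω (τ ω) - ω (σ ω)‖ := by
    rcases le_total (σ ω) (τ ω) with hle | hle
    · rw [max_eq_right hle, min_eq_left hle]
    · rw [max_eq_left hle, min_eq_right hle, norm_sub_rev]
  simpa only [hnorm, Nat.cast_max, Nat.cast_min, max_sub_min_eq_abs] using h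

end SquaredDisplacement

section BoundaryStrip

lemma exists_frontier_dist_le {E : Type*} [NormedAddCommGroup E] [NormedSpace ℝ E]
    [FiniteDimensional ℝ E] {A : Set E} (hA : A.Nonempty) {x : E} (hx : x ∉ A) {r : ℝ}
    (hr : Metric.infDist x A ≤ r) : ∃ y ∈ frontier A, dist x y ≤ r := by
  obtain ⟨y, hy, hxy⟩ := exists_mem_frontier_infDist_compl_eq_dist (s := Aᶜ) hx
    (Set.compl_ne_univ.2 hA)
  rw [frontier_compl] at hy
  rw [compl_compl] at hxy
  exact ⟨y, hy, hxy ▸ hr⟩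

variable {n : ℕ} {Ω : Set (Space n)} {T ε : ℝ}

lemma closure_cylinder (hT : 0 < T) :
    closure (cylinder Ω T) = closure Ω ×ˢ Set.Icc 0 T := by
  rw [cylinder, closure_prod_eq, closure_Ioo hT.ne]

lemma boundaryStrip_mono {ε' : ℝ} (hε : 0 ≤ ε) (hεε' : ε ≤ ε') :
    boundaryStrip Ω T ε ⊆ boundaryStrip Ω T ε' := by
  have hsq : -ε' ^ 2 ≤ -ε ^ 2 := by gcongr
  exact Set.union_subset_union
    (Set.prod_mono (fun x hx => ⟨hx.1, hx.2.trans hεε'⟩) (Set.Icc_subset_Icc_left hsq))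
    (Set.prod_mono_right (Set.Icc_subset_Icc_left hsq))

lemma boundaryStrip_nonempty (hne : Ω.Nonempty) : (boundaryStrip Ω T ε).Nonempty :=
  (hne.prod (Set.nonempty_Icc.2 (neg_nonpos.2 (sq_nonneg ε)))).mono Set.subset_union_right

lemma frontier_subset_outerStrip (hΩ : IsOpen Ω) (hε : 0 ≤ ε) : frontier Ω ⊆ outerStrip Ω ε :=
  fun _ hx => ⟨(hΩ.frontier_eq ▸ hx).2, (Metric.infDist_zero_of_mem hx).trans_le hε⟩

lemma isCompact_outerStrip (hΩ : IsOpen Ω) (hb : Bornology.IsBounded Ω)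
    (hfr : (frontier Ω).Nonempty) : IsCompact (outerStrip Ω ε) := by
  refine Metric.isCompact_of_isClosed_isBounded (hΩ.isClosed_compl.inter
    (isClosed_le (Metric.continuous_infDist_pt _) continuous_const)) ?_
  refine ((hb.closure.subset frontier_subset_closure).thickening (δ := ε + 1)).subset fun x hx => ?_
  exact Metric.mem_thickening_iff.2
    ((Metric.infDist_lt_iff hfr).1 (hx.2.trans_lt (lt_add_one ε)))

lemma isCompact_boundaryStrip (hΩ : IsOpen Ω) (hb : Bornology.IsBounded Ω)
    (hfr : (frontier Ω).Nonempty) (hT : 0 ≤ T) (hε : 0 ≤ ε) : IsCompact (boundaryStrip Ω T ε) := by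
  have hclosure : boundaryStrip Ω T ε
      = outerStrip Ω ε ×ˢ Set.Icc (-ε ^ 2) T ∪ closure Ω ×ˢ Set.Icc (-ε ^ 2) 0 := by
    refine (Set.union_subset_union_right _ (Set.prod_mono_left subset_closure)).antisymm
      (Set.union_subset Set.subset_union_left ?_)
    rw [closure_eq_self_union_frontier, Set.union_prod]
    exact Set.union_subset Set.subset_union_right ((Set.prod_mono
      (frontier_subset_outerStrip hΩ hε) (Set.Icc_subset_Icc_right hT)).trans
        Set.subset_union_left)
  rw [hclosure]
  exact ((isCompact_outerStrip hΩ hb hfr).prod isCompact_Icc).union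
    (hb.isCompact_closure.prod isCompact_Icc)

lemma exists_parabolic_modulus {E : Type*} [SeminormedAddCommGroup E] {F : E × ℝ → ℝ}
    {A : Set (E × ℝ)} (hA : IsCompact A) (hF : ContinuousOn F A) {η : ℝ} (hη : 0 < η) :
    ∃ C, 0 ≤ C ∧ ∀ X ∈ A, ∀ Y ∈ A, |F X - F Y| ≤ η + C * (‖X.1 - Y.1‖ ^ 2 + |X.2 - Y.2|) := by
  obtain ⟨M, hM⟩ := hA.exists_bound_of_continuousOn hF
  obtain ⟨d, hd, hdF⟩ := Metric.uniformContinuousOn_iff.1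
    (hA.uniformContinuousOn_of_continuous hF) η hη
  set m := min (d ^ 2) d
  have hm : 0 < m := by positivity
  refine ⟨2 * |M| / m, by positivity, fun X hX Y hY => ?_⟩
  set q := ‖X.1 - Y.1‖ ^ 2 + |X.2 - Y.2|
  have hq : 0 ≤ q := by positivity
  rcases lt_or_ge (dist X Y) d with hlt | hge
  · exact (hdF X hX Y hY hlt).le.trans (le_add_of_nonneg_right (mul_nonneg (by positivity) hq))
  · have hmq : m ≤ q := by
      rw [Prod.dist_eq, le_max_iff, dist_eq_norm, Real.dist_eq] at hge
      rcases hge with hspace | htime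
      · calc m ≤ d ^ 2 := min_le_left _ _
          _ ≤ ‖X.1 - Y.1‖ ^ 2 := by gcongr
          _ ≤ q := le_add_of_nonneg_right (abs_nonneg _)
      · calc m ≤ d := min_le_right _ _
          _ ≤ |X.2 - Y.2| := htime
          _ ≤ q := le_add_of_nonneg_left (by positivity)
    have hbound : ∀ X ∈ A, |F X| ≤ |M| := fun X hX => (hM X hX).trans (le_abs_self M)
    calc |F X - F Y| ≤ |F X| + |F Y| := abs_sub _ _
      _ ≤ |M| + |M| := add_le_add (hbound X hX) (hbound Y hY)
      _ = 2 * |M| / m * m := by field_simp; ring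
      _ ≤ 2 * |M| / m * q := by gcongr
      _ ≤ η + 2 * |M| / m * q := le_add_of_nonneg_left hη.le

end BoundaryStrip

section AdmissiblePath

variable {n : ℕ} {p ε T t : ℝ} {Ω : Set (Space n)} {K : ℕ} {v w : ℕ → Space n}

lemma IsAdmissiblePath.infDist_le (hw : IsAdmissiblePath Ω ε w) {k : ℕ}
    (hk : k ≤ exitRound Ω K w) : Metric.infDist (w k) Ω ≤ ε := by
  rcases k with _ | k
  · rw [Metric.infDist_zero_of_mem_closure hw.zero_mem]
    exact (norm_nonneg _).trans (hw.norm_sub_le 0)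
  · refine (Metric.infDist_le_dist_of_mem (mem_of_lt_exitRound (Nat.lt_of_succ_le hk))).trans ?_
    rw [dist_eq_norm]
    exact hw.norm_sub_le k

variable {G : Space n → ℝ} {L : NNReal} {ε₁ : ℝ}

lemma IsBarrier.le_mul_of_infDist_le (hG : IsBarrier p Ω G L ε₁) (hne : Ω.Nonempty) {x : Space n}
    (hx : Metric.infDist x Ω ≤ ε) : G x ≤ L * ε := by
  by_cases hxΩ : x ∈ Ω
  · exact (hG.nonpos_of_mem x hxΩ).trans (mul_nonneg L.2 (Metric.infDist_nonneg.trans hx))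
  · obtain ⟨y, hy, hxy⟩ := exists_frontier_dist_le hne hxΩ hx
    calc G x ≤ G y + L * dist x y := hG.lipschitzWith.le_add_mul x y
      _ ≤ L * ε := by rw [hG.eq_zero_of_mem_frontier y hy, zero_add]; gcongr

lemma IsBarrier.neg_mul_le_of_notMem (hG : IsBarrier p Ω G L ε₁) (hne : Ω.Nonempty)
    {x : Space n} (hxΩ : x ∉ Ω) (hx : Metric.infDist x Ω ≤ ε) : -(L * ε) ≤ G x := by
  obtain ⟨y, hy, hxy⟩ := exists_frontier_dist_le hne hxΩ hx
  have hLip := hG.lipschitzWith.le_add_mul y x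
  rw [hG.eq_zero_of_mem_frontier y hy, dist_comm] at hLip
  have : L * dist x y ≤ L * ε := by gcongr
  linarith

/-- If `v` leaves `Ω` first, then both `v` and `w` are near `∂Ω`, where the barrier vanishes, so the
barrier along `w` cannot increase much before `w` leaves `Ω`, too. -/
lemma IsBarrier.sub_le_of_isAdmissiblePath (hG : IsBarrier p Ω G L ε₁) (hne : Ω.Nonempty)
    (hv : IsAdmissiblePath Ω ε v) (hw : IsAdmissiblePath Ω ε w) {d : ℝ}
    (hd : ∀ k, ‖v k - w k‖ ≤ d) :
    G (w (exitRound Ω K w)) - G (w (min (exitRound Ω K v) (exitRound Ω K w)))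
      ≤ L * (2 * ε + d) := by
  have hε : 0 ≤ ε := (norm_nonneg _).trans (hw.norm_sub_le 0)
  have hd₀ : 0 ≤ d := (norm_nonneg _).trans (hd 0)
  rcases le_or_gt (exitRound Ω K w) (exitRound Ω K v) with hle | hlt
  · rw [min_eq_right hle, sub_self]
    positivity
  · rw [min_eq_left hlt.le]
    have hupper := hG.le_mul_of_infDist_le hne (hw.infDist_le (le_refl (exitRound Ω K w)))
    have hlower := hG.neg_mul_le_of_notMem hne
      (notMem_or_le_exitRound.resolve_right (hlt.trans_le exitRound_le).not_ge)
      (hv.infDist_le (le_refl (exitRound Ω K v)))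
    have hLip := hG.lipschitzWith.le_add_mul (v (exitRound Ω K v)) (w (exitRound Ω K v))
    have : L * dist (v (exitRound Ω K v)) (w (exitRound Ω K v)) ≤ L * d := by
      rw [dist_eq_norm]
      gcongr
      exact hd _
    linarith

/-- The number of rounds of a game that starts at time `t` if the token moves along `ω`. -/
noncomputable def duration (Ω : Set (Space n)) (ε t : ℝ) (ω : ℕ → Space n) : ℕ :=
  exitRound Ω ⌈t / ε ^ 2⌉₊ ω

/-- The final token of a game that starts at time `t` if the token moves along `ω`. -/
noncomputable def exitToken (Ω : Set (Space n)) (ε t : ℝ) (ω : ℕ → Space n) : Space n × ℝ :=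
  token ε t ω (duration Ω ε t ω)

lemma neg_sq_le_snd_exitToken (hε : 0 < ε) (ht : 0 ≤ t) (ω : ℕ → Space n) :
    -ε ^ 2 ≤ (exitToken Ω ε t ω).2 := by
  change -ε ^ 2 ≤ t - duration Ω ε t ω * ε ^ 2
  have hlt : (duration Ω ε t ω : ℝ) < t / ε ^ 2 + 1 :=
    (Nat.cast_le.2 exitRound_le).trans_lt (Nat.ceil_lt_add_one (by positivity))
  have hmul : duration Ω ε t ω * ε ^ 2 ≤ (t / ε ^ 2 + 1) * ε ^ 2 := by gcongr
  rw [add_mul, div_mul_cancel₀ _ (by positivity)] at hmul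
  linarith

lemma ceil_le_iff_sub_nonpos (hε : 0 < ε) {k : ℕ} : ⌈t / ε ^ 2⌉₊ ≤ k ↔ t - k * ε ^ 2 ≤ 0 := by
  rw [Nat.ceil_le, div_le_iff₀ (by positivity), sub_nonpos]

lemma IsAdmissiblePath.exitToken_mem_boundaryStrip (hw : IsAdmissiblePath Ω ε w) (hε : 0 < ε)
    (hne : Ω.Nonempty) (ht : t ∈ Set.Icc 0 T) : exitToken Ω ε t w ∈ boundaryStrip Ω T ε := by
  have hlo := neg_sq_le_snd_exitToken (Ω := Ω) hε ht.1 w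
  by_cases hmem : w (duration Ω ε t w) ∈ Ω
  · exact Or.inr ⟨hmem, hlo, (ceil_le_iff_sub_nonpos hε).1
      (notMem_or_le_exitRound.resolve_left (not_not.2 hmem))⟩
  · obtain ⟨y, hy, hxy⟩ := exists_frontier_dist_le hne hmem (hw.infDist_le le_rfl)
    have hhi : (exitToken Ω ε t w).2 ≤ T := (sub_le_self _ (by positivity)).trans ht.2
    exact Or.inl ⟨⟨hmem, (Metric.infDist_le_dist_of_mem hy).trans hxy⟩, hlo, hhi⟩

lemma IsAdmissiblePath.token_stoppingRound (hw : IsAdmissiblePath Ω ε w) (hε : 0 < ε)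
    (hne : Ω.Nonempty) (ht : t ∈ Set.Icc 0 T) :
    token ε t w (stoppingRound Ω T ε t w) = exitToken Ω ε t w := by
  have hmem := hw.exitToken_mem_boundaryStrip hε hne ht
  have heq : stoppingRound Ω T ε t w = duration Ω ε t w := by
    refine (Nat.sInf_le hmem).antisymm (le_csInf ⟨_, hmem⟩ fun k hk => Nat.sInf_le ?_)
    rcases hk with ⟨hout, -⟩ | ⟨-, htime⟩
    · exact Or.inl hout.1
    · exact Or.inr ((ceil_le_iff_sub_nonpos hε).2 htime.2)
  rw [heq, exitToken]

lemma parabolic_dist_exitToken_le (a b : Space n) (t u : ℝ) (ω : ℕ → Space n) :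
    ‖(exitToken Ω ε t (ω · + a)).1 - (exitToken Ω ε u (ω · + b)).1‖ ^ 2
        + |(exitToken Ω ε t (ω · + a)).2 - (exitToken Ω ε u (ω · + b)).2|
      ≤ 2 * ‖ω (duration Ω ε t (ω · + a)) - ω (duration Ω ε u (ω · + b))‖ ^ 2
        + ε ^ 2 * |(duration Ω ε t (ω · + a) : ℝ) - duration Ω ε u (ω · + b)|
        + (2 * ‖a - b‖ ^ 2 + |t - u|) := by
  simp only [exitToken, token]
  generalize duration Ω ε t (ω · + a) = i
  generalize duration Ω ε u (ω · + b) = j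
  have hspace : ‖ω i + a - (ω j + b)‖ ^ 2 ≤ 2 * ‖ω i - ω j‖ ^ 2 + 2 * ‖a - b‖ ^ 2 := by
    rw [add_sub_add_comm, ← mul_add]
    exact (pow_le_pow_left₀ (norm_nonneg _) (norm_add_le _ _) 2).trans add_sq_le
  have htime : |t - i * ε ^ 2 - (u - j * ε ^ 2)| ≤ ε ^ 2 * |(i : ℝ) - j| + |t - u| := by
    rw [show t - i * ε ^ 2 - (u - j * ε ^ 2) = t - u - ε ^ 2 * (i - j) by ring, add_comm]
    refine (abs_sub _ _).trans_eq ?_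
    rw [abs_mul, abs_of_nonneg (sq_nonneg ε)]
  linarith

lemma abs_duration_sub_le (hε : 0 < ε) (ht : 0 ≤ t) {u : ℝ} (hu : 0 ≤ u) :
    |(duration Ω ε t v : ℝ) - duration Ω ε u w|
      ≤ |(exitRound Ω ⌈t / ε ^ 2⌉₊ v : ℝ) - exitRound Ω ⌈t / ε ^ 2⌉₊ w|
        + (|t - u| / ε ^ 2 + 1) := by
  have hceil : |(⌈t / ε ^ 2⌉₊ : ℝ) - ⌈u / ε ^ 2⌉₊| ≤ |t - u| / ε ^ 2 + 1 := by
    rw [← abs_of_pos (pow_pos hε 2), ← abs_div, sub_div, abs_of_pos (pow_pos hε 2)]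
    have htl := Nat.le_ceil (t / ε ^ 2)
    have htu := Nat.ceil_lt_add_one (div_nonneg ht (sq_nonneg ε))
    have hul := Nat.le_ceil (u / ε ^ 2)
    have huu := Nat.ceil_lt_add_one (div_nonneg hu (sq_nonneg ε))
    rw [abs_le]
    constructor <;> linarith [le_abs_self (t / ε ^ 2 - u / ε ^ 2),
      neg_abs_le (t / ε ^ 2 - u / ε ^ 2)]
  have hcap : |(exitRound Ω ⌈t / ε ^ 2⌉₊ w : ℝ) - exitRound Ω ⌈u / ε ^ 2⌉₊ w|
      ≤ |(⌈t / ε ^ 2⌉₊ : ℝ) - ⌈u / ε ^ 2⌉₊| :=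
    abs_exitRound_sub_le _ _ _ _
  exact (abs_sub_le _ _ _).trans (add_le_add_right (hcap.trans hceil) _)

end AdmissiblePath

section Game

variable {n : ℕ} {p ε : ℝ} {hp : 2 < p} {hε : 0 < ε} {S : Strategy n} {P : Space n × ℝ}

instance : IsProbabilityMeasure (gameMeasure hp hε S P) :=
  inferInstanceAs (IsProbabilityMeasure (walkMeasure (stepKernel hp hε S P.2) P.1))

lemma isSymmetricWalk_stepKernel (t : ℝ) : IsSymmetricWalk (stepKernel hp hε S t) ε :=
  fun k h => isSymmetricStep_stepMeasure hε.le (S.norm_dir k t h)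

lemma ae_isAdmissiblePath_add {Ω : Set (Space n)} {a : Space n} (ha : P.1 + a ∈ closure Ω) :
    ∀ᵐ ω ∂gameMeasure hp hε S P, IsAdmissiblePath Ω ε (ω · + a) :=
  (isSymmetricWalk_stepKernel P.2).ae_isAdmissiblePath_add ha

/-- The strategy `S` carried over to the game translated by `V` in space-time. -/
def Strategy.translate (S : Strategy n) (V : Space n × ℝ) : Strategy n where
  dir k t h := S.dir k (t - V.2) fun j => h j - V.1
  measurable_dir k := by
    have hmeas : Measurable fun q : ℝ × (Finset.Iic k → Space n) =>
        (q.1 - V.2, (fun j => q.2 j - V.1 : Finset.Iic k → Space n)) := by fun_prop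
    exact (S.measurable_dir k).comp hmeas
  norm_dir k t h := S.norm_dir k (t - V.2) fun j => h j - V.1

lemma gameMeasure_translate (V : Space n × ℝ) :
    gameMeasure hp hε (S.translate V) (P + V)
      = (gameMeasure hp hε S P).map fun ω k => ω k + V.1 := by
  refine (map_traj_of_intertwining (e := fun _ => (· + V.1)) (by fun_prop) fun k h => ?_).symm
  simp only [stepKernel, Kernel.coe_mk, Strategy.translate, Prod.snd_add, add_sub_cancel_right]
  exact map_add_right_stepMeasure V.1

end Game

section Duration

variable {n : ℕ} {p ε ε₁ t u : ℝ} {hp : 2 < p} {hε : 0 < ε} {S : Strategy n} {P : Space n × ℝ}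
  {Ω : Set (Space n)} {G : Space n → ℝ} {L : NNReal} {a b : Space n}

lemma isStoppingRound_exitRound_add (hΩ : IsOpen Ω) (K : ℕ) (a : Space n) :
    IsStoppingRound (X := fun _ => Space n) fun ω => exitRound Ω K (ω · + a) :=
  (isStoppingRound_exitRound hΩ.measurableSet K).comp_map (Y := fun _ => Space n)
    (e := fun _ => (· + a)) (by fun_prop)

lemma integrable_exitRound_add (hΩ : IsOpen Ω) (K : ℕ) (a : Space n) :
    Integrable (fun ω => (exitRound Ω K (ω · + a) : ℝ)) (gameMeasure hp hε S P) :=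
  integrable_natCast_of_le (isStoppingRound_exitRound_add hΩ K a).measurable fun _ => exitRound_le

lemma integrable_exitRound_add_sub_min (hΩ : IsOpen Ω) (K : ℕ) (a b : Space n) :
    Integrable (fun ω => (exitRound Ω K (ω · + b) : ℝ)
      - (min (exitRound Ω K (ω · + a)) (exitRound Ω K (ω · + b)) : ℕ))
      (gameMeasure hp hε S P) := by
  simp only [Nat.cast_min]
  exact (integrable_exitRound_add hΩ K b).sub
    ((integrable_exitRound_add hΩ K a).inf (integrable_exitRound_add hΩ K b))

lemma IsBarrier.sq_mul_integral_exitRound_sub_min_le (hG : IsBarrier p Ω G L ε₁) (hΩ : IsOpen Ω)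
    (hne : Ω.Nonempty) (hεε₁ : ε < ε₁) (ha : P.1 + a ∈ closure Ω) (hb : P.1 + b ∈ closure Ω)
    (K : ℕ) :
    ε ^ 2 * ∫ ω, ((exitRound Ω K (ω · + b) : ℝ)
        - (min (exitRound Ω K (ω · + a)) (exitRound Ω K (ω · + b)) : ℕ)) ∂gameMeasure hp hε S P
      ≤ L * (2 * ε + ‖a - b‖) := by
  have hκ := isSymmetricWalk_stepKernel (hp := hp) (hε := hε) (S := S) P.2
  have ha' := isStoppingRound_exitRound_add hΩ K a
  have hb' := isStoppingRound_exitRound_add hΩ K b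
  have hGc : Continuous G := hG.lipschitzWith.continuous
  have hf : Continuous (Function.uncurry fun x y => G (x + b) - G (y + b)) := by fun_prop
  have hle (ω : ℕ → Space n) : exitRound Ω K (ω · + b) ≤ K := exitRound_le
  refine (hκ.mul_integral_sub_le (x₀ := P.1) (ha'.min hb') hb' (fun _ => min_le_right _ _) hle hf
    (fun _ => sub_self _) fun k ω _ hk => ?_).trans ?_
  · have hdrift := hG.drift ε hε hεε₁ _ (mem_of_lt_exitRound hk) _ (S.norm_dir k P.2
      (Preorder.frestrictLe (π := fun _ => Space n) k ω))
    rw [← map_add_right_stepMeasure, integral_map (by fun_prop) (by fun_prop)] at hdrift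
    rw [integral_sub ((hκ k _).integrable_of_continuous (by fun_prop)) (integrable_const _),
      integral_const, probReal_univ, one_smul, sub_add_eq_add_sub]
    exact sub_le_sub_right hdrift _
  · refine (integral_mono_ae (hκ.integrable_comp_eval hf (ha'.min hb').measurable hb'.measurable
      (fun _ => (min_le_right _ _).trans (hle _)) hle)
      (integrable_const (L * (2 * ε + ‖a - b‖))) ?_).trans_eq (by simp)
    filter_upwards [hκ.ae_isAdmissiblePath_add ha, hκ.ae_isAdmissiblePath_add hb] with ω hωa hωb
    exact hG.sub_le_of_isAdmissiblePath hne hωa hωb fun k => by rw [add_sub_add_left_eq_sub]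

lemma abs_natCast_sub_eq_sub_min_add_sub_min (i j : ℕ) :
    |(i : ℝ) - j| = (j - (min i j : ℕ)) + (i - (min j i : ℕ)) := by
  rw [min_comm j i, Nat.cast_min, ← max_sub_min_eq_abs']
  linarith [min_add_max (i : ℝ) j]

lemma IsBarrier.sq_mul_integral_abs_exitRound_sub_le (hG : IsBarrier p Ω G L ε₁)
    (hΩ : IsOpen Ω) (hne : Ω.Nonempty) (hεε₁ : ε < ε₁) (ha : P.1 + a ∈ closure Ω)
    (hb : P.1 + b ∈ closure Ω) (K : ℕ) :
    ε ^ 2 * ∫ ω, |(exitRound Ω K (ω · + a) : ℝ) - exitRound Ω K (ω · + b)| ∂gameMeasure hp hε S P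
      ≤ 2 * L * (2 * ε + ‖a - b‖) := by
  have hab := hG.sq_mul_integral_exitRound_sub_min_le (hp := hp) (hε := hε) (S := S) hΩ hne
    hεε₁ ha hb K
  have hba := hG.sq_mul_integral_exitRound_sub_min_le (hp := hp) (hε := hε) (S := S) hΩ hne
    hεε₁ hb ha K
  rw [norm_sub_rev] at hba
  simp only [abs_natCast_sub_eq_sub_min_add_sub_min]
  rw [integral_add (integrable_exitRound_add_sub_min hΩ K a b)
    (integrable_exitRound_add_sub_min hΩ K b a), mul_add]
  linarith

lemma measurable_duration_add (hΩ : IsOpen Ω) (ε t : ℝ) (a : Space n) :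
    Measurable fun ω : ℕ → Space n => duration Ω ε t (ω · + a) :=
  (isStoppingRound_exitRound_add hΩ _ a).measurable

lemma integrable_abs_duration_sub (hΩ : IsOpen Ω) :
    Integrable (fun ω => |(duration Ω ε t (ω · + a) : ℝ) - duration Ω ε u (ω · + b)|)
      (gameMeasure hp hε S P) :=
  ((integrable_exitRound_add hΩ _ a).sub (integrable_exitRound_add hΩ _ b)).abs

lemma IsBarrier.sq_mul_integral_abs_duration_sub_le (hG : IsBarrier p Ω G L ε₁) (hΩ : IsOpen Ω)
    (hne : Ω.Nonempty) (hεε₁ : ε < ε₁) (ha : P.1 + a ∈ closure Ω) (hb : P.1 + b ∈ closure Ω)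
    (ht : 0 ≤ t) (hu : 0 ≤ u) :
    ε ^ 2 * ∫ ω, |(duration Ω ε t (ω · + a) : ℝ) - duration Ω ε u (ω · + b)|
        ∂gameMeasure hp hε S P
      ≤ 2 * L * (2 * ε + ‖a - b‖) + |t - u| + ε ^ 2 := by
  have hint : Integrable (fun ω => |(exitRound Ω ⌈t / ε ^ 2⌉₊ (ω · + a) : ℝ)
      - exitRound Ω ⌈t / ε ^ 2⌉₊ (ω · + b)|) (gameMeasure hp hε S P) :=
    ((integrable_exitRound_add hΩ _ a).sub (integrable_exitRound_add hΩ _ b)).abs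
  have hmono := integral_mono (integrable_abs_duration_sub hΩ)
    (hint.add (integrable_const (|t - u| / ε ^ 2 + 1)))
    fun ω => abs_duration_sub_le (v := (ω · + a)) (w := (ω · + b)) hε ht hu
  rw [integral_add' hint (integrable_const _), integral_const, probReal_univ, one_smul] at hmono
  refine (mul_le_mul_of_nonneg_left hmono (sq_nonneg ε)).trans ?_
  rw [mul_add, mul_add, mul_div_cancel₀ _ (pow_pos hε 2).ne', mul_one, ← add_assoc]
  gcongr ?_ + _ + _
  exact hG.sq_mul_integral_abs_exitRound_sub_le hΩ hne hεε₁ ha hb _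

end Duration

section Payoff

variable {n : ℕ} {p ε ε₁ t u T : ℝ} {hp : 2 < p} {hε : 0 < ε} {S : Strategy n} {P : Space n × ℝ}
  {Ω : Set (Space n)} {F : Space n × ℝ → ℝ} {G : Space n → ℝ} {L : NNReal} {a b : Space n}

lemma ae_exitToken_mem_boundaryStrip (hne : Ω.Nonempty) (hε1 : ε < 1)
    (ha : P.1 + a ∈ closure Ω) (ht : t ∈ Set.Icc 0 T) :
    ∀ᵐ ω ∂gameMeasure hp hε S P, exitToken Ω ε t (ω · + a) ∈ boundaryStrip Ω T 1 := by
  filter_upwards [ae_isAdmissiblePath_add ha] with ω hω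
  exact boundaryStrip_mono hε.le hε1.le (hω.exitToken_mem_boundaryStrip hε hne ht)

lemma expectedPayoff_eq (hne : Ω.Nonempty) (hP : P ∈ closure Ω ×ˢ Set.Icc 0 T) :
    expectedPayoff hp hε Ω T F S P = ∫ ω, F (exitToken Ω ε P.2 ω) ∂gameMeasure hp hε S P := by
  refine integral_congr_ae ?_
  filter_upwards [ae_isAdmissiblePath_add (a := 0) (by simpa using hP.1)] with ω hω
  simp only [add_zero] at hω
  rw [hω.token_stoppingRound hε hne hP.2]

lemma expectedPayoff_translate (hne : Ω.Nonempty) {V : Space n × ℝ}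
    (hV : P + V ∈ closure Ω ×ˢ Set.Icc 0 T) :
    expectedPayoff hp hε Ω T F (S.translate V) (P + V)
      = ∫ ω, F (exitToken Ω ε (P.2 + V.2) (ω · + V.1)) ∂gameMeasure hp hε S P := by
  have hemb : MeasurableEmbedding fun (ω : ℕ → Space n) k => ω k + V.1 :=
    (MeasurableEquiv.addRight fun _ : ℕ => V.1).measurableEmbedding
  rw [expectedPayoff_eq hne hV, gameMeasure_translate, hemb.integral_map, Prod.snd_add]

lemma abs_expectedPayoff_le (hne : Ω.Nonempty) {M : ℝ}
    (hM : ∀ Q ∈ boundaryStrip Ω T 1, |F Q| ≤ M) (hε1 : ε < 1)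
    (hP : P ∈ closure Ω ×ˢ Set.Icc 0 T) : |expectedPayoff hp hε Ω T F S P| ≤ M := by
  have hbound : ∀ᵐ ω ∂gameMeasure hp hε S P, ‖F (exitToken Ω ε P.2 ω)‖ ≤ M := by
    filter_upwards [ae_exitToken_mem_boundaryStrip (a := 0) hne hε1 (by simpa using hP.1) hP.2]
      with ω hω
    simp only [add_zero] at hω
    exact hM _ hω
  rw [expectedPayoff_eq hne hP]
  simpa using norm_integral_le_of_norm_le_const hbound

lemma measurable_exitToken_add (hΩ : IsOpen Ω) (ε t : ℝ) (a : Space n) :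
    Measurable fun ω : ℕ → Space n => exitToken Ω ε t (ω · + a) := by
  have hdur := measurable_duration_add hΩ ε t a
  exact ((measurable_eval_comp hdur).add_const a).prodMk (by fun_prop)

lemma integrable_comp_exitToken (hΩ : IsOpen Ω) (hne : Ω.Nonempty)
    (hΓ : IsCompact (boundaryStrip Ω T 1)) (hF : ContinuousOn F (boundaryStrip Ω T 1))
    (hε1 : ε < 1) (ha : P.1 + a ∈ closure Ω) (ht : t ∈ Set.Icc 0 T) :
    Integrable (fun ω => F (exitToken Ω ε t (ω · + a))) (gameMeasure hp hε S P) := by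
  classical
  obtain ⟨M, hM⟩ := hΓ.exists_bound_of_continuousOn hF
  have hmem := ae_exitToken_mem_boundaryStrip (hp := hp) (hε := hε) (S := S) hne hε1 ha ht
  have hmeas : Measurable ((boundaryStrip Ω T 1).piecewise F fun _ => 0) :=
    hF.measurable_piecewise continuousOn_const hΓ.measurableSet
  refine Integrable.of_bound ((hmeas.comp
    (measurable_exitToken_add hΩ ε t a)).aestronglyMeasurable.congr ?_) M ?_
  · filter_upwards [hmem] with ω hω
    exact Set.piecewise_eq_of_mem _ _ _ hω
  · filter_upwards [hmem] with ω hω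
    exact hM _ hω

lemma integrable_norm_sub_duration_sq (hΩ : IsOpen Ω) :
    Integrable
      (fun ω => ‖ω (duration Ω ε t (ω · + a)) - ω (duration Ω ε u (ω · + b))‖ ^ 2)
      (gameMeasure hp hε S P) :=
  (isSymmetricWalk_stepKernel P.2).integrable_comp_eval (f := fun x y => ‖x - y‖ ^ 2)
    (by fun_prop) (measurable_duration_add hΩ ε u b) (measurable_duration_add hΩ ε t a)
    (fun _ => exitRound_le.trans (le_max_right _ _)) fun _ => exitRound_le.trans (le_max_left _ _)

lemma integral_norm_sub_duration_sq_le (hΩ : IsOpen Ω) :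
    ∫ ω, ‖ω (duration Ω ε t (ω · + a)) - ω (duration Ω ε u (ω · + b))‖ ^ 2
        ∂gameMeasure hp hε S P
      ≤ ε ^ 2 * ∫ ω, |(duration Ω ε t (ω · + a) : ℝ) - duration Ω ε u (ω · + b)|
        ∂gameMeasure hp hε S P :=
  (isSymmetricWalk_stepKernel P.2).integral_norm_sub_sq_le
    (isStoppingRound_exitRound_add hΩ _ b) (isStoppingRound_exitRound_add hΩ _ a)
    (fun _ => exitRound_le.trans (le_max_right _ _)) fun _ => exitRound_le.trans (le_max_left _ _)

lemma integral_abs_sub_comp_exitToken_le (hΩ : IsOpen Ω) (hne : Ω.Nonempty)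
    (hΓ : IsCompact (boundaryStrip Ω T 1)) (hF : ContinuousOn F (boundaryStrip Ω T 1))
    {η C : ℝ} (hC : 0 ≤ C) (hmod : ∀ X ∈ boundaryStrip Ω T 1, ∀ Y ∈ boundaryStrip Ω T 1,
      |F X - F Y| ≤ η + C * (‖X.1 - Y.1‖ ^ 2 + |X.2 - Y.2|)) (hε1 : ε < 1)
    (ha : P.1 + a ∈ closure Ω) (hb : P.1 + b ∈ closure Ω)
    (ht : t ∈ Set.Icc 0 T) (hu : u ∈ Set.Icc 0 T) :
    ∫ ω, |F (exitToken Ω ε t (ω · + a)) - F (exitToken Ω ε u (ω · + b))| ∂gameMeasure hp hε S P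
      ≤ η + C * (3 * (ε ^ 2 * ∫ ω, |(duration Ω ε t (ω · + a) : ℝ) - duration Ω ε u (ω · + b)|
        ∂gameMeasure hp hε S P) + (2 * ‖a - b‖ ^ 2 + |t - u|)) := by
  have hspace := integrable_norm_sub_duration_sq (hp := hp) (hε := hε) (S := S) (P := P)
    (t := t) (u := u) (a := a) (b := b) hΩ |>.const_mul 2
  have hround := integrable_abs_duration_sub (hp := hp) (hε := hε) (S := S) (P := P)
    (t := t) (u := u) (a := a) (b := b) hΩ |>.const_mul (ε ^ 2)
  have hconst : Integrable (fun _ => 2 * ‖a - b‖ ^ 2 + |t - u|) (gameMeasure hp hε S P) :=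
    integrable_const _
  have hdist := (hspace.add hround).add hconst
  refine (integral_mono_ae ((integrable_comp_exitToken hΩ hne hΓ hF hε1 ha ht).sub
    (integrable_comp_exitToken hΩ hne hΓ hF hε1 hb hu)).abs
    ((integrable_const η).add (hdist.const_mul C)) ?_).trans ?_
  · filter_upwards [ae_exitToken_mem_boundaryStrip hne hε1 ha ht,
      ae_exitToken_mem_boundaryStrip hne hε1 hb hu] with ω hωa hωb
    refine (hmod _ hωa _ hωb).trans (add_le_add_right (mul_le_mul_of_nonneg_left ?_ hC) η)
    exact parabolic_dist_exitToken_le a b t u ω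
  · rw [integral_add' (integrable_const η) (hdist.const_mul C), integral_const_mul,
      integral_add' (hspace.add hround) hconst, integral_add' hspace hround, integral_const_mul,
      integral_const_mul, integral_const, integral_const, probReal_univ, one_smul, one_smul]
    gcongr
    linarith [integral_norm_sub_duration_sq_le (hp := hp) (hε := hε) (S := S) (P := P) (t := t)
      (u := u) (a := a) (b := b) hΩ]

lemma IsBarrier.abs_expectedPayoff_sub_translate_le (hG : IsBarrier p Ω G L ε₁) (hΩ : IsOpen Ω)
    (hne : Ω.Nonempty) (hΓ : IsCompact (boundaryStrip Ω T 1))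
    (hF : ContinuousOn F (boundaryStrip Ω T 1)) {η C : ℝ} (hC : 0 ≤ C)
    (hmod : ∀ X ∈ boundaryStrip Ω T 1, ∀ Y ∈ boundaryStrip Ω T 1,
      |F X - F Y| ≤ η + C * (‖X.1 - Y.1‖ ^ 2 + |X.2 - Y.2|))
    (hε1 : ε < 1) (hεε₁ : ε < ε₁) {V : Space n × ℝ} (hP : P ∈ closure Ω ×ˢ Set.Icc 0 T)
    (hV : P + V ∈ closure Ω ×ˢ Set.Icc 0 T) :
    |expectedPayoff hp hε Ω T F S P - expectedPayoff hp hε Ω T F (S.translate V) (P + V)|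
      ≤ η + C * (3 * (2 * L * (2 * ε + ‖V.1‖) + |V.2| + ε ^ 2) + (2 * ‖V.1‖ ^ 2 + |V.2|)) := by
  have hP₁ : P.1 + 0 ∈ closure Ω := by simpa using hP.1
  have hint := integrable_comp_exitToken (hp := hp) (hε := hε) (S := S) hΩ hne hΓ hF hε1 hP₁ hP.2
  have hint' := integrable_comp_exitToken (hp := hp) (hε := hε) (S := S) hΩ hne hΓ hF hε1 hV.1 hV.2
  have hdur := hG.sq_mul_integral_abs_duration_sub_le (hp := hp) (hε := hε) (S := S) hΩ hne hεε₁
    hP₁ hV.1 hP.2.1 hV.2.1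
  have hmain := integral_abs_sub_comp_exitToken_le (hp := hp) (hε := hε) (S := S) hΩ hne hΓ hF hC
    hmod hε1 hP₁ hV.1 hP.2 hV.2
  simp only [Prod.snd_add, add_zero, zero_sub, norm_neg, sub_add_cancel_left, abs_neg]
    at hint hint' hdur hmain
  rw [expectedPayoff_eq hne hP, expectedPayoff_translate hne hV, ← integral_sub hint hint']
  refine (abs_integral_le_integral_abs.trans hmain).trans ?_
  gcongr

end Payoff

section Value

variable {n : ℕ} {p ε T : ℝ} {hp : 2 < p} {hε : 0 < ε} {P : Space n × ℝ} {Ω : Set (Space n)}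
  {F : Space n × ℝ → ℝ}

lemma nonempty_strategy (hn : 1 ≤ n) : Nonempty (Strategy n) :=
  ⟨⟨fun _ _ _ => EuclideanSpace.single ⟨0, hn⟩ 1, fun _ => measurable_const, fun _ _ _ => by simp⟩⟩

lemma expectedPayoff_le_value (hne : Ω.Nonempty) {M : ℝ}
    (hM : ∀ Q ∈ boundaryStrip Ω T 1, |F Q| ≤ M) (hε1 : ε < 1)
    (hP : P ∈ closure Ω ×ˢ Set.Icc 0 T) (S : Strategy n) :
    expectedPayoff hp hε Ω T F S P ≤ value hp hε Ω T F P := by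
  refine le_ciSup (f := fun S => expectedPayoff hp hε Ω T F S P) ⟨M, ?_⟩ S
  rintro _ ⟨S', rfl⟩
  exact (abs_le.1 (abs_expectedPayoff_le hne hM hε1 hP)).2

lemma abs_value_le (hn : 1 ≤ n) (hne : Ω.Nonempty) {M : ℝ}
    (hM : ∀ Q ∈ boundaryStrip Ω T 1, |F Q| ≤ M) (hε1 : ε < 1)
    (hP : P ∈ closure Ω ×ˢ Set.Icc 0 T) : |value hp hε Ω T F P| ≤ M := by
  have hpayoff (S : Strategy n) :=
    abs_le.1 (abs_expectedPayoff_le (hp := hp) (hε := hε) (S := S) hne hM hε1 hP)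
  obtain ⟨S⟩ := nonempty_strategy hn
  have : Nonempty (Strategy n) := ⟨S⟩
  exact abs_le.2 ⟨(hpayoff S).1.trans (expectedPayoff_le_value hne hM hε1 hP S),
    ciSup_le fun S => (hpayoff S).2⟩

lemma norm_fst_sub_le_spaceTimeDist (P Q : Space n × ℝ) : ‖P.1 - Q.1‖ ≤ spaceTimeDist P Q :=
  Real.le_sqrt_of_sq_le (le_add_of_nonneg_right (sq_nonneg _))

lemma abs_snd_sub_le_spaceTimeDist (P Q : Space n × ℝ) : |P.2 - Q.2| ≤ spaceTimeDist P Q := by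
  refine Real.le_sqrt_of_sq_le ?_
  rw [sq_abs]
  exact le_add_of_nonneg_left (sq_nonneg _)

lemma spaceTimeDist_comm (P Q : Space n × ℝ) : spaceTimeDist P Q = spaceTimeDist Q P := by
  rw [spaceTimeDist, spaceTimeDist, norm_sub_rev, ← neg_sub Q.2 P.2, neg_sq]

lemma exists_pos_lt_comp_le {e : ℝ → ℝ} (he : Continuous e) (he₀ : e 0 = 0) {ε₁ η : ℝ}
    (hε₁ : 0 < ε₁) (hη : 0 < η) : ∃ ρ > 0, ρ < ε₁ ∧ e ρ < η := by
  have hsmall : ∀ᶠ ρ in nhdsWithin 0 (Set.Ioi 0), e ρ < η :=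
    ((he.tendsto' 0 0 he₀).mono_left nhdsWithin_le_nhds).eventually_lt_const hη
  obtain ⟨ρ, hρ, hρε₁⟩ := (hsmall.and (Ioo_mem_nhdsGT hε₁)).exists
  exact ⟨ρ, hρε₁.1, hρε₁.2, hρ⟩

lemma exists_value_le_value_add (hn : 1 ≤ n) (hp : 2 < p) (hΩ : IsOpen Ω) (hne : Ω.Nonempty)
    (hΓ : IsCompact (boundaryStrip Ω T 1)) (hF : ContinuousOn F (boundaryStrip Ω T 1))
    {G : Space n → ℝ} {L : NNReal} {ε₁ : ℝ} (hε₁ : 0 < ε₁) (hG : IsBarrier p Ω G L ε₁) {η : ℝ}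
    (hη : 0 < η) :
    ∃ ρ > 0, ∀ (ε : ℝ) (hε : 0 < ε), ε < 1 → ε < ρ →
      ∀ P ∈ closure Ω ×ˢ Set.Icc 0 T, ∀ Q ∈ closure Ω ×ˢ Set.Icc 0 T, spaceTimeDist P Q < ρ →
        value hp hε Ω T F P ≤ value hp hε Ω T F Q + η := by
  have := nonempty_strategy hn
  obtain ⟨M, hM⟩ := hΓ.exists_bound_of_continuousOn hF
  obtain ⟨C, hC, hmod⟩ := exists_parabolic_modulus hΓ hF (half_pos hη)
  obtain ⟨ρ, hρ, hρε₁, herror⟩ := exists_pos_lt_comp_le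
    (e := fun r => C * (3 * (2 * L * (2 * r + r) + r + r ^ 2) + (2 * r ^ 2 + r)))
    (by fun_prop) (by simp) hε₁ (half_pos hη)
  refine ⟨ρ, hρ, fun ε hε hε1 hερ P hP Q hQ hPQ => ciSup_le fun S => ?_⟩
  have hQP : P + (Q - P) = Q := add_sub_cancel P Q
  have hspace : ‖(Q - P).1‖ ≤ ρ := by
    rw [Prod.fst_sub, norm_sub_rev]
    exact (norm_fst_sub_le_spaceTimeDist P Q).trans hPQ.le
  have htime : |(Q - P).2| ≤ ρ := by
    rw [Prod.snd_sub, abs_sub_comm]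
    exact (abs_snd_sub_le_spaceTimeDist P Q).trans hPQ.le
  have hpayoff := hG.abs_expectedPayoff_sub_translate_le (hp := hp) (hε := hε) (S := S) hΩ hne hΓ
    hF hC hmod hε1 (hερ.trans hρε₁) hP (hQP.symm ▸ hQ)
  have hvalue := expectedPayoff_le_value (hp := hp) (hε := hε) hne hM hε1 hQ (S.translate (Q - P))
  have hmono : C * (3 * (2 * L * (2 * ε + ‖(Q - P).1‖) + |(Q - P).2| + ε ^ 2)
        + (2 * ‖(Q - P).1‖ ^ 2 + |(Q - P).2|))
      ≤ C * (3 * (2 * L * (2 * ρ + ρ) + ρ + ρ ^ 2) + (2 * ρ ^ 2 + ρ)) := by gcongr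
  rw [hQP] at hpayoff
  linarith [(abs_le.1 hpayoff).2]

lemma IsGameDomain.exists_hasExteriorBalls (hΩ : IsGameDomain Ω) :
    ∃ δ > 0, HasExteriorBalls Ω δ := by
  obtain ⟨δ, hδ, hball⟩ := hΩ.exteriorSphere
  refine ⟨δ, hδ, fun y hy => ?_⟩
  obtain ⟨z, hz, hzy⟩ := hball y hy
  exact ⟨z, hz, (hzy.ge (Set.mem_singleton y)).1⟩

end Value

end DominativeGame

open DominativeGame in
theorem lemma4p2_general {n : ℕ} (hn : 1 ≤ n) {p : ℝ} (hp : 2 < p) {Ω : Set (Space n)}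
    (hΩ : IsOpen Ω) (hne : Ω.Nonempty) (hb : Bornology.IsBounded Ω) {δ : ℝ} (hδ : 0 < δ)
    (hext : HasExteriorBalls Ω δ) {T : ℝ} (hT : 0 < T) (F : Space n × ℝ → ℝ)
    (hF : ContinuousOn F (boundaryStrip Ω T 1)) :
    (∃ M : ℝ, IsGreatest ((fun Q => |F Q|) '' boundaryStrip Ω T 1) M ∧
      ∀ (ε : ℝ) (hε : 0 < ε), ε < 1 → ∀ P ∈ closure (cylinder Ω T),
        |value hp hε Ω T F P| ≤ M) ∧
    (∀ η : ℝ, 0 < η → ∃ r₀ : ℝ, 0 < r₀ ∧ ∃ ε₀ : ℝ, 0 < ε₀ ∧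
      ∀ (ε : ℝ) (hε : 0 < ε), ε < 1 → ε < ε₀ →
        ∀ P ∈ closure (cylinder Ω T), ∀ Q ∈ closure (cylinder Ω T), spaceTimeDist P Q < r₀ →
          |value hp hε Ω T F P - value hp hε Ω T F Q| < η) := by
  have := nontrivial_space hn
  have hΓ := isCompact_boundaryStrip hΩ hb (nonempty_frontier_of_isBounded hne hb) hT.le
    zero_le_one
  rw [closure_cylinder hT]
  refine ⟨?_, fun η hη => ?_⟩
  · obtain ⟨M, hM⟩ := (hΓ.image_of_continuousOn hF.abs).exists_isGreatest
      ((boundaryStrip_nonempty hne).image _)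
    exact ⟨M, hM, fun ε hε hε1 P hP =>
      abs_value_le hn hne (fun Q hQ => hM.2 (Set.mem_image_of_mem _ hQ)) hε1 hP⟩
  · obtain ⟨ε₁, hε₁, G, L, hG⟩ := exists_isBarrier hp hne hb hδ hext
    obtain ⟨ρ, hρ, hvalue⟩ :=
      exists_value_le_value_add hn hp hΩ hne hΓ hF hε₁ hG (half_pos hη)
    refine ⟨ρ, hρ, ρ, hρ, fun ε hε hε1 hερ P hP Q hQ hPQ => abs_sub_lt_iff.2 ⟨?_, ?_⟩⟩
    · linarith [hvalue ε hε hε1 hερ P hP Q hQ hPQ]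
    · linarith [hvalue ε hε hε1 hερ Q hQ P hP (spaceTimeDist_comm P Q ▸ hPQ)]

theorem lemma4p2 {n : ℕ} (hn : 1 ≤ n) {p : ℝ} (hp : 2 < p)
    {Ω : Set (DominativeGame.Space n)} (hΩ : DominativeGame.IsGameDomain Ω)
    {T : ℝ} (hT : 0 < T) (F : DominativeGame.Space n × ℝ → ℝ)
    (hF : ContinuousOn F (DominativeGame.boundaryStrip Ω T 1)) :
    (∃ M : ℝ, IsGreatest ((fun Q => |F Q|) '' DominativeGame.boundaryStrip Ω T 1) M ∧
      ∀ (ε : ℝ) (hε : 0 < ε), ε < 1 → ∀ P ∈ closure (DominativeGame.cylinder Ω T),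
        |DominativeGame.value hp hε Ω T F P| ≤ M) ∧
    (∀ η : ℝ, 0 < η → ∃ r₀ : ℝ, 0 < r₀ ∧ ∃ ε₀ : ℝ, 0 < ε₀ ∧
      ∀ (ε : ℝ) (hε : 0 < ε), ε < 1 → ε < ε₀ →
        ∀ P ∈ closure (DominativeGame.cylinder Ω T),
        ∀ Q ∈ closure (DominativeGame.cylinder Ω T),
          DominativeGame.spaceTimeDist P Q < r₀ →
          |DominativeGame.value hp hε Ω T F P - DominativeGame.value hp hε Ω T F Q| < η) := by
  obtain ⟨δ, hδ, hext⟩ := hΩ.exists_hasExteriorBalls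
  exact lemma4p2_general hn hp hΩ.isOpen hΩ.isConnected.nonempty hΩ.isBounded hδ hext hT F hF
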